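/- \textbf{Theorem (spectral representation of the minimal extension).} Let $\mathcal H$ be a separable complex Hilbert space, $\Omega$ a (possibly unbounded) self-adjoint operator in $\mathcal H$, $H_1\subset\mathcal H$ a closed subspace, $H_2=H_1^\perp$, and suppose that with respect to $\mathcal H=H_1\oplus H_2$ $$\Omega=\begin{bmatrix}\Omega_1&\Gamma\\ \Gamma^\dagger&\Omega_2\end{bmatrix},\qquad \operatorname{dom}\Omega=\operatorname{dom}\Omega_1\oplus\operatorname{dom}\Omega_2,$$ where $\Omega_i$ is self-adjoint in $H_i$ and the coupling operator $\Gamma:H_2\to H_1$ is bounded. Put $\mathring\Gamma=\begin{bmatrix}0&\Gamma\\ \Gamma^\dagger&0\end{bmatrix}$, let $P_1$ be the orthogonal projection onto $H_1$, and let $dE_\lambda$ be the spectral resolution of the identity of $\Omega$. For a self-adjoint operator $A$ and a set $S$ of vectors, the orbit $\mathcal O_A(S)$ is the closed linear span of $\{f(A)v: f\in C_c(\mathbb R),\ v\in S\}$; a subspace $K$ is $A$-invariant if $\mathcal O_A(K)=K$. The open system obtained by projecting the dynamics onto $H_1$ is $(H_1,\Omega_1,a_1)$ with friction function $a_1(t)=\Gamma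 e^{-it\Omega_2}\Gamma^\dagger$, $t\ge 0$; likewise $(H_2,\Omega_2,a_2)$ with $a_2(t)=\Gamma^\dagger e^{-it\Omega_1}\Gamma$. For an open system $(G,\Omega_G,a)$ with $G$ a closed subspace of $\mathcal H$, a subspace $K$ of $\mathcal H$ (with the operator $\Omega|_K$) is called its minimal conservative extension if $K$ is $\Omega$-invariant and there are a closed subspace $G'\perp G$ with $K=G\oplus G'$, a self-adjoint $\Omega'$ in $G'$ and a bounded $\Gamma':G'\to G$ such that $\Omega|_K=\begin{bmatrix}\Omega_G&\Gamma'\\ \Gamma'^\dagger&\Omega'\end{bmatrix}$, $a(t)=\Gamma' e^{-it\Omega'}\Gamma'^\dagger$ for all $t\ge 0$, and $\mathcal O_{\Omega'}(\operatorname{Ran}\Gamma'^\dagger)=G'$. The system $(\mathcal H=H_1\oplus H_2,\Omega)$ is called reconstructible if $\mathcal H$ is the minimal conservative extension of both $(H_1,\Omega_1,a_1)$ and $(H_2,\Omega_2,a_2)$. Say that $\Omega$ has pure point spectrum if its eigenvectors span a dense subspace; an eigenmode is a (nonzero) eigenvector; for an eigenvalue $\lambda_\alpha$ let $\pi_\alpha$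 be the orthogonal projection onto its eigenspace. Then there is exactly one subspace $\mathcal H_{\min}$ of $\mathcal H$ that is the minimal conservative extension of $(H_1,\Omega_1,a_1)$, and $\mathcal H_{\min}=\mathcal O_\Omega(H_1)$. If $H_1$ contains no nonzero $\Omega$-invariant subspace, then also $\mathcal H_{\min}=\mathcal O_\Omega(\operatorname{Ran}\mathring\Gamma)$. Moreover: (i) If $\Omega$ has pure point spectrum, then $\Omega$ has at most countably many eigenvalues $\lambda_\alpha$, the subspaces $\pi_\alpha(H_1)$ are mutually orthogonal, and $\mathcal H_{\min}$ is the closure of their sum, $\mathcal H_{\min}=\bigoplus_\alpha\pi_\alpha(H_1)$. If in addition $H_1$ contains no nonzero $\Omega$-invariant subspace, the same holds with $\operatorname{Ran}\mathring\Gamma$ in place of $H_1$: $\mathcal H_{\min}=\bigoplus_\alpha\pi_\alpha(\operatorname{Ran}\mathring\Gamma)$. (ii) For arbitrary spectrum, $\mathcal H_{\min}$ is the closed linear span of the vectors $\int_\Delta dE_\lambda v$, where $v\in H_1$ and $\Delta$ is an interval of $\mathbb R$. If $H_1$ contains no nonzero $\Omega$-invariant subspace, the same holds with $v\in\operatorname{Ran}\mathring\Gamma$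 in place of $v\in H_1$. In both statements, for any $\epsilon>0$, it is enough to use those intervals $\Delta$ that lie in an interval of length $\epsilon$. (iii) If $\Omega$ has pure point spectrum, then $\mathcal H_{\min}=\mathcal H$ if and only if $P_1\phi\neq0$ for each eigenmode $\phi$ of $\Omega$. If in addition $H_1$ contains no nonzero $\Omega$-invariant subspace, then $\mathcal H_{\min}=\mathcal H$ if and only if $\mathring\Gamma\phi\neq 0$ for each eigenmode $\phi$ of $\Omega$. Finally, if $\Omega$ has pure point spectrum (with no condition on $H_1$), $(\mathcal H=H_1\oplus H_2,\Omega)$ is reconstructible if and only if $\mathring\Gamma\phi\neq0$ for each eigenmode $\phi$ of $\Omega$. -/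

import Mathlib

noncomputable section
namespace OpenSystems
open scoped InnerProductSpace CompactlySupported ComplexOrder
open MeasureTheory

section Calculus
variable {E : Type*} [NormedAddCommGroup E] [InnerProductSpace ℂ E] [CompleteSpace E]

/-- Self-adjointness (of a possibly unbounded operator) read on the graph. -/
theorem mem_graph_iff_of_isSelfAdjoint {T : E →ₗ.[ℂ] E} (hT : IsSelfAdjoint T) (x y : E) :
    (x, y) ∈ T.graph ↔ ∀ a b, (a, b) ∈ T.graph → ⟪b, x⟫_ℂ = ⟪a, y⟫_ℂ := by
  have h := LinearPMap.adjoint_graph_eq_graph_adjoint hT.dense_domain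
  rw [LinearPMap.isSelfAdjoint_def.mp hT] at h
  rw [h, Submodule.mem_adjoint_iff, ← h]
  simp only [sub_eq_zero]

theorem norm_sq_add_smul {T : E →ₗ.[ℂ] E} (hT : IsSelfAdjoint T) {x y : E}
    (h : (x, y) ∈ T.graph) (c : ℂ) (hc : c = Complex.I ∨ c = -Complex.I) :
    ‖y + c • x‖ ^ 2 = ‖y‖ ^ 2 + ‖x‖ ^ 2 := by
  have h1 := (mem_graph_iff_of_isSelfAdjoint hT x y).mp h x y h
  have h2 : (⟪y, x⟫_ℂ).im = 0 := by
    exact Complex.conj_eq_iff_im.mp (by rw [inner_conj_symm, h1])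
  have h3 := norm_add_sq (𝕜 := ℂ) y (c • x)
  rw [inner_smul_right, norm_smul] at h3
  rcases hc with rfl | rfl <;> simp [h2] at h3 <;> simp [h3]

/-- The ranges of `T + i` and `T - i` are everything. -/
theorem surjective_add_smul {T : E →ₗ.[ℂ] E} (hT : IsSelfAdjoint T)
    (c : ℂ) (hc : c = Complex.I ∨ c = -Complex.I) (z : E) :
    ∃ x y, (x, y) ∈ T.graph ∧ y + c • x = z := by
  let A : T.graph →L[ℂ] E :=
    (ContinuousLinearMap.snd ℂ E E + c • ContinuousLinearMap.fst ℂ E E).comp T.graph.subtypeL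
  have hA : ∀ p : T.graph, A p = p.1.2 + c • p.1.1 := fun p => rfl
  have hcl : IsClosed (T.graph : Set (E × E)) := hT.isClosed
  have : CompleteSpace T.graph := hcl.completeSpace_coe
  have hanti : AntilipschitzWith 1 A := by
    refine AddMonoidHomClass.antilipschitz_of_bound A (K := 1) (fun p => ?_)
    obtain ⟨⟨x, y⟩, hp⟩ := p
    have h := norm_sq_add_smul hT hp c hc
    simp only [NNReal.coe_one, one_mul]
    change max ‖x‖ ‖y‖ ≤ ‖y + c • x‖
    refine max_le ?_ ?_ <;> refine le_of_sq_le_sq ?_ (norm_nonneg _) <;>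
      nlinarith [sq_nonneg ‖x‖, sq_nonneg ‖y‖]
  have hrc : IsClosed (Set.range A) := hanti.isClosed_range A.uniformContinuous
  have hrange : A.range = ⊤ := by
    have hcl' : IsClosed (A.range : Set E) := hrc
    have : CompleteSpace A.range := hcl'.completeSpace_coe
    rw [← Submodule.orthogonal_eq_bot_iff, Submodule.eq_bot_iff]
    intro w hw
    have hw' : ∀ a b, (a, b) ∈ T.graph → ⟪b + c • a, w⟫_ℂ = 0 := fun a b hab =>
      (Submodule.mem_orthogonal _ _).mp hw _ ⟨⟨(a, b), hab⟩, rfl⟩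
    have hg : (w, c • w) ∈ T.graph := by
      rw [mem_graph_iff_of_isSelfAdjoint hT]
      intro a b hab
      have := hw' a b hab
      rw [inner_add_left, inner_smul_left] at this
      rw [inner_smul_right]
      rcases hc with rfl | rfl <;> simp at this ⊢ <;> linear_combination this
    have h1 := hw' w (c • w) hg
    rw [← two_smul ℂ, inner_smul_left, inner_smul_left] at h1
    have hc0 : c ≠ 0 := by rcases hc with rfl | rfl <;> simp
    simpa [hc0] using h1
  have hz : z ∈ A.range := hrange ▸ Submodule.mem_top
  obtain ⟨⟨⟨x, y⟩, hp⟩, rfl⟩ := hz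
  exact ⟨x, y, hp, rfl⟩

theorem exists_cayley (T : E →ₗ.[ℂ] E) (hT : IsSelfAdjoint T) :
    ∃ U : unitary (E →L[ℂ] E), ∀ x y, (x, y) ∈ T.graph →
      (U : E →L[ℂ] E) (y + Complex.I • x) = y - Complex.I • x := by
  let A : ℂ → T.graph →ₗ[ℂ] E := fun c =>
    (LinearMap.snd ℂ E E + c • LinearMap.fst ℂ E E).comp T.graph.subtype
  have hbij : ∀ c : ℂ, c = Complex.I ∨ c = -Complex.I → Function.Bijective (A c) := by
    intro c hc
    refine ⟨?_, fun z => ?_⟩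
    · rw [← LinearMap.ker_eq_bot, LinearMap.ker_eq_bot']
      rintro ⟨⟨x, y⟩, hp⟩ h0
      have h := norm_sq_add_smul hT hp c hc
      have h0' : y + c • x = 0 := h0
      rw [h0', norm_zero] at h
      have hx : ‖x‖ = 0 := by nlinarith [sq_nonneg ‖x‖, sq_nonneg ‖y‖]
      have hy : ‖y‖ = 0 := by nlinarith [sq_nonneg ‖x‖, sq_nonneg ‖y‖]
      simp only [norm_eq_zero] at hx hy
      simp [hx, hy]
    · obtain ⟨x, y, hp, h⟩ := surjective_add_smul hT c hc z
      exact ⟨⟨(x, y), hp⟩, h⟩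
  let e₁ := LinearEquiv.ofBijective (A Complex.I) (hbij _ (Or.inl rfl))
  let e₂ := LinearEquiv.ofBijective (A (-Complex.I)) (hbij _ (Or.inr rfl))
  let V : E ≃ₗᵢ[ℂ] E :=
    { e₁.symm.trans e₂ with
      norm_map' := by
        intro z
        obtain ⟨p, rfl⟩ := e₁.surjective z
        change ‖e₂ (e₁.symm (e₁ p))‖ = ‖e₁ p‖
        rw [LinearEquiv.symm_apply_apply]
        obtain ⟨⟨x, y⟩, hp⟩ := p
        change ‖y + -Complex.I • x‖ = ‖y + Complex.I • x‖
        rw [← sq_eq_sq₀ (norm_nonneg _) (norm_nonneg _),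
          norm_sq_add_smul hT hp _ (Or.inr rfl), norm_sq_add_smul hT hp _ (Or.inl rfl)] }
  refine ⟨Unitary.linearIsometryEquiv.symm V, fun x y hp => ?_⟩
  have h1 : y + Complex.I • x = e₁ ⟨(x, y), hp⟩ := rfl
  rw [h1]
  change e₂ (e₁.symm (e₁ _)) = _
  rw [LinearEquiv.symm_apply_apply]
  change y + -Complex.I • x = _
  rw [neg_smul, sub_eq_add_neg]

/-- The Cayley transform `U = (T - i) (T + i)⁻¹` of a self-adjoint operator `T`, a unitary operator.
It is determined by `cayley_spec`, since `T + i` is onto by `surjective_add_smul`. -/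
def cayley (T : E →ₗ.[ℂ] E) (hT : IsSelfAdjoint T) : unitary (E →L[ℂ] E) :=
  (exists_cayley T hT).choose

theorem cayley_spec (T : E →ₗ.[ℂ] E) (hT : IsSelfAdjoint T) {x y : E} (h : (x, y) ∈ T.graph) :
    (cayley T hT : E →L[ℂ] E) (y + Complex.I • x) = y - Complex.I • x :=
  (exists_cayley T hT).choose_spec x y h

/-- Transport of a function on `ℝ` to the unit circle along the inverse Cayley map
`z ↦ i (1 + z) / (1 - z)`, which sends `(s - i) / (s + i)` to `s`; the value at `z = 1`
(the point at infinity) is `0`. -/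
def circleFun (f : ℝ → ℂ) (z : ℂ) : ℂ :=
  if z = 1 then 0 else f (Complex.I * (1 + z) / (1 - z)).re

theorem continuousOn_circleFun (f : C_c(ℝ, ℂ)) :
    ContinuousOn (circleFun f) (Metric.sphere 0 1) := by
  intro z hz
  by_cases h1 : z = 1
  · subst h1
    obtain ⟨r, hr⟩ := f.hasCompactSupport.isCompact.isBounded.subset_closedBall 0
    have hev : ∀ᶠ w in nhdsWithin (1 : ℂ) (Metric.sphere 0 1), circleFun f w = 0 := by
      have hn : ∀ᶠ w : ℂ in nhds 1, 1 - 1 / (r ^ 2 + 1) < w.re :=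
        Complex.continuous_re.continuousAt.eventually_const_lt (by
          simp only [Complex.one_re]
          have : 0 < 1 / (r ^ 2 + 1) := by positivity
          linarith)
      filter_upwards [nhdsWithin_le_nhds hn, self_mem_nhdsWithin] with w hw hs
      by_cases hw1 : w = 1
      · simp [circleFun, hw1]
      simp only [circleFun, hw1, if_false]
      have hsq : w.re ^ 2 + w.im ^ 2 = 1 := by
        have : ‖w‖ = 1 := by simpa using hs
        rw [← Complex.normSq_add_mul_I w.re w.im, Complex.re_add_im, Complex.normSq_eq_norm_sq, this]
        norm_num
      have hre : w.re ≠ 1 := by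
        intro h
        apply hw1
        apply Complex.ext
        · simpa using h
        · have : w.im ^ 2 = 0 := by rw [h] at hsq; linarith
          simpa using this
      have hlt : w.re < 1 := lt_of_le_of_ne (by nlinarith [sq_nonneg w.im, sq_nonneg w.re]) hre
      have hval : (Complex.I * (1 + w) / (1 - w)).re = -w.im / (1 - w.re) := by
        have hd : Complex.normSq (1 - w) = 2 * (1 - w.re) := by
          rw [Complex.normSq_apply]; simp; nlinarith
        rw [Complex.div_re, hd]
        have : 1 - w.re ≠ 0 := by linarith
        simp
        field_simp
        ring
      by_contra hne
      have hm := hr (subset_tsupport _ hne)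
      rw [hval, Metric.mem_closedBall, dist_zero_right, Real.norm_eq_abs] at hm
      have hm2 : (-w.im / (1 - w.re)) ^ 2 ≤ r ^ 2 := sq_le_sq.mpr (hm.trans (le_abs_self r))
      have hd : 0 < 1 - w.re := by linarith
      rw [div_pow, div_le_iff₀ (by positivity)] at hm2
      have hb : (1 - w.re) * (r ^ 2 + 1) < 1 := by
        rw [← lt_div_iff₀ (by positivity)]; linarith
      have hfac : (-w.im) ^ 2 = (1 - w.re) * (1 + w.re) := by nlinarith
      have : 1 + w.re ≤ r ^ 2 * (1 - w.re) := by
        rw [hfac] at hm2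
        nlinarith
      nlinarith
    have h0 : circleFun f 1 = 0 := by simp [circleFun]
    rw [ContinuousWithinAt, h0]
    exact tendsto_const_nhds.congr' (hev.mono fun w hw => hw.symm)
  · have hev : circleFun f =ᶠ[nhds z] fun w => f (Complex.I * (1 + w) / (1 - w)).re := by
      filter_upwards [isOpen_ne.mem_nhds h1] with w hw
      simp [circleFun, show w ≠ 1 from hw]
    refine (ContinuousAt.congr ?_ hev.symm).continuousWithinAt
    refine f.continuous.continuousAt.comp (Complex.continuous_re.continuousAt.comp ?_)
    exact ContinuousAt.div (by fun_prop) (by fun_prop) (sub_ne_zero.mpr (Ne.symm h1))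

/-- The operator `f(T)`, for a self-adjoint `T` and a continuous compactly supported `f` on `ℝ`:
the continuous functional calculus of the unitary Cayley transform, applied to the function that
`f` induces on the unit circle. -/
def ccCalculus (T : E →ₗ.[ℂ] E) (hT : IsSelfAdjoint T) (f : ℝ → ℂ) : E →L[ℂ] E :=
  cfc (circleFun f) (cayley T hT : E →L[ℂ] E)

theorem continuousOn_spectrum (T : E →ₗ.[ℂ] E) (hT : IsSelfAdjoint T) (f : C_c(ℝ, ℂ)) :
    ContinuousOn (circleFun f) (spectrum ℂ (cayley T hT : E →L[ℂ] E)) :=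
  (continuousOn_circleFun f).mono (spectrum.subset_circle_of_unitary (cayley T hT).2)

def toComplex (f : C_c(ℝ, ℝ)) : C_c(ℝ, ℂ) := f.compLeft ⟨Complex.ofReal, Complex.continuous_ofReal⟩

@[simp] theorem toComplex_apply (f : C_c(ℝ, ℝ)) (x : ℝ) : toComplex f x = (f x : ℂ) := by
  simp [toComplex, CompactlySupportedContinuousMap.compLeft_apply]

/-- The positive functional `f ↦ ⟪v, f(T) v⟫` on real `f ∈ C_c(ℝ)`. -/
def spectralFunctional (T : E →ₗ.[ℂ] E) (hT : IsSelfAdjoint T) (v : E) : C_c(ℝ, ℝ) →ₚ[ℝ] ℝ :=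
  PositiveLinearMap.mk₀
    { toFun := fun f => (⟪v, ccCalculus T hT (toComplex f) v⟫_ℂ).re
      map_add' := fun f g => by
        have h : circleFun (toComplex (f + g)) =
            fun z => circleFun (toComplex f) z + circleFun (toComplex g) z := by
          funext z
          by_cases hz : z = 1 <;> simp [circleFun, hz]
        rw [ccCalculus, h, cfc_add _ _ _ (continuousOn_spectrum T hT _)
          (continuousOn_spectrum T hT _)]
        simp [ccCalculus]
      map_smul' := fun r f => by
        have h : circleFun (toComplex (r • f)) =
            fun z => (r : ℂ) * circleFun (toComplex f) z := by
          funext z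
          by_cases hz : z = 1 <;> simp [circleFun, hz]
        rw [ccCalculus, h, cfc_const_mul _ _ _ (continuousOn_spectrum T hT _)]
        simp [ccCalculus] }
    (fun f hf => by
      have h : 0 ≤ ccCalculus T hT (toComplex f) := by
        refine cfc_nonneg fun z _ => ?_
        by_cases hz : z = 1
        · simp [circleFun, hz]
        · simp only [circleFun, hz, if_false, toComplex_apply]
          exact_mod_cast hf _
      exact ((ContinuousLinearMap.nonneg_iff_isPositive _).mp h).re_inner_nonneg_right v)

/-- The spectral measure of `T` at the vector `v`: the Borel measure on `ℝ` with
`∫ f dμ_v = ⟪v, f(T) v⟫` for `f ∈ C_c(ℝ)`. -/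
def spectralMeasure (T : E →ₗ.[ℂ] E) (hT : IsSelfAdjoint T) (v : E) : Measure ℝ :=
  RealRMK.rieszMeasure (spectralFunctional T hT v)

theorem spectralFunctional_apply (T : E →ₗ.[ℂ] E) (hT : IsSelfAdjoint T) (v : E)
    (f : C_c(ℝ, ℝ)) :
    spectralFunctional T hT v f = (⟪v, ccCalculus T hT (toComplex f) v⟫_ℂ).re := rfl

theorem spectralMeasure_univ_le (T : E →ₗ.[ℂ] E) (hT : IsSelfAdjoint T) (v : E) :
    spectralMeasure T hT v Set.univ ≤ ENNReal.ofReal (‖v‖ ^ 2) := by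
  have : (spectralMeasure T hT v).Regular := RealRMK.regular_rieszMeasure _
  rw [isOpen_univ.measure_eq_iSup_isCompact]
  refine iSup_le fun K => iSup_le fun _ => iSup_le fun hK => ?_
  obtain ⟨f, hf1, hf2, -, hf3⟩ :=
    exists_continuousMap_one_of_isCompact_subset_isOpen hK isOpen_univ (Set.subset_univ K)
  let F : C_c(ℝ, ℝ) := ⟨f, hf2⟩
  refine (RealRMK.rieszMeasure_le_of_eq_one (f := F) _ (fun x => (hf3 x).1) hK
    (fun x hx => hf1 hx)).trans (ENNReal.ofReal_le_ofReal ?_)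
  rw [spectralFunctional_apply]
  have hn : ‖ccCalculus T hT (toComplex F)‖ ≤ 1 := by
    refine norm_cfc_le zero_le_one fun z _ => ?_
    by_cases hz : z = 1
    · simp [circleFun, hz]
    · simp only [circleFun, hz, if_false, toComplex_apply, Complex.norm_real, Real.norm_eq_abs]
      exact abs_le.mpr ⟨(neg_nonpos.mpr zero_le_one).trans (hf3 _).1, (hf3 _).2⟩
  calc (⟪v, ccCalculus T hT (toComplex F) v⟫_ℂ).re
      ≤ ‖⟪v, ccCalculus T hT (toComplex F) v⟫_ℂ‖ := Complex.re_le_norm _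
    _ ≤ ‖v‖ * ‖ccCalculus T hT (toComplex F) v‖ := norm_inner_le_norm _ _
    _ ≤ ‖v‖ * (1 * ‖v‖) := by
        gcongr
        exact (ContinuousLinearMap.le_opNorm _ _).trans (by gcongr)
    _ = ‖v‖ ^ 2 := by ring

instance (T : E →ₗ.[ℂ] E) (hT : IsSelfAdjoint T) (v : E) :
    IsFiniteMeasure (spectralMeasure T hT v) :=
  ⟨(spectralMeasure_univ_le T hT v).trans_lt ENNReal.ofReal_lt_top⟩

theorem integral_spectralMeasure (T : E →ₗ.[ℂ] E) (hT : IsSelfAdjoint T) (v : E)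
    (f : C_c(ℝ, ℝ)) : ∫ x, f x ∂(spectralMeasure T hT v) =
      (⟪v, ccCalculus T hT (toComplex f) v⟫_ℂ).re :=
  RealRMK.integral_rieszMeasure _ f

/-- A relation between quadratic forms that holds for all operators passes to spectral integrals. -/
theorem sum_integral_eq_zero (T : E →ₗ.[ℂ] E) (hT : IsSelfAdjoint T) {n : ℕ} (c : Fin n → ℝ)
    (v : Fin n → E)
    (h : ∀ A : E →L[ℂ] E, ∑ i, c i * (⟪v i, A (v i)⟫_ℂ).re = 0)
    {g : ℝ → ℂ} (hg : Measurable g) {C : ℝ} (hC : ∀ x, ‖g x‖ ≤ C) :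
    ∑ i, (c i : ℂ) * ∫ x, g x ∂(spectralMeasure T hT (v i)) = 0 := by
  let P : Measure ℝ := ∑ i, (c i).toNNReal • spectralMeasure T hT (v i)
  let N : Measure ℝ := ∑ i, (-c i).toNNReal • spectralMeasure T hT (v i)
  have hint : ∀ {F : Type} [NormedAddCommGroup F] [NormedSpace ℝ F] (d : Fin n → NNReal)
      (k : ℝ → F), (∀ i, Integrable k (spectralMeasure T hT (v i))) →
      ∫ x, k x ∂(∑ i, d i • spectralMeasure T hT (v i)) =
        ∑ i, (d i : ℝ) • ∫ x, k x ∂(spectralMeasure T hT (v i)) := by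
    intro F _ _ d k hk
    rw [integral_finsetSum_measure fun i _ => (hk i).smul_measure_nnreal]
    exact Finset.sum_congr rfl fun i _ => integral_smul_nnreal_measure _ _
  have hcoe : ∀ r : ℝ, ((r.toNNReal : ℝ) - ((-r).toNNReal : ℝ)) = r := fun r => by
    simp only [Real.coe_toNNReal']
    exact max_zero_sub_max_neg_zero_eq_self r
  have hPN : P = N := by
    refine Measure.ext_of_integral_eq_on_compactlySupported fun f => ?_
    have hk : ∀ i, Integrable (fun x => f x) (spectralMeasure T hT (v i)) := fun i => f.integrable
    rw [hint _ _ hk, hint _ _ hk, ← sub_eq_zero, ← Finset.sum_sub_distrib]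
    simp only [smul_eq_mul, ← sub_mul, hcoe, integral_spectralMeasure]
    exact h _
  have hk : ∀ i, Integrable g (spectralMeasure T hT (v i)) := fun i =>
    Integrable.of_bound hg.aestronglyMeasurable C (Filter.Eventually.of_forall hC)
  have h1 := hint (fun i => (c i).toNNReal) g hk
  have h2 := hint (fun i => (-c i).toNNReal) g hk
  have h3 : ∫ x, g x ∂P = ∫ x, g x ∂N := by rw [hPN]
  rw [h1, h2, ← sub_eq_zero, ← Finset.sum_sub_distrib] at h3
  simp only [← sub_smul, hcoe] at h3
  simpa only [Complex.real_smul] using h3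

/-- The real-bilinear form obtained from `v ↦ ∫ g dμ_v` by polarization. -/
def spectralForm (T : E →ₗ.[ℂ] E) (hT : IsSelfAdjoint T) (g : ℝ → ℂ) (u v : E) : ℂ :=
  (1 / 4 : ℝ) * ((∫ x, g x ∂(spectralMeasure T hT (u + v))) -
    ∫ x, g x ∂(spectralMeasure T hT (u - v)))

theorem spectralForm_add_right (T : E →ₗ.[ℂ] E) (hT : IsSelfAdjoint T) {g : ℝ → ℂ}
    (hg : Measurable g) {C : ℝ} (hC : ∀ x, ‖g x‖ ≤ C)
    (u v w : E) : spectralForm T hT g u (v + w) =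
    spectralForm T hT g u v + spectralForm T hT g u w := by
  have h := sum_integral_eq_zero T hT ![1 / 4, -(1 / 4), -(1 / 4), 1 / 4, -(1 / 4), 1 / 4]
    ![u + (v + w), u - (v + w), u + v, u - v, u + w, u - w]
    (fun A => by simp [Fin.sum_univ_succ]; ring) hg hC
  simp [Fin.sum_univ_succ] at h
  simp only [spectralForm]
  push_cast
  linear_combination h

theorem spectralForm_smul_right (T : E →ₗ.[ℂ] E) (hT : IsSelfAdjoint T) {g : ℝ → ℂ}
    (hg : Measurable g) {C : ℝ} (hC : ∀ x, ‖g x‖ ≤ C)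
    (u v : E) (r : ℝ) : spectralForm T hT g u ((r : ℂ) • v) =
    (r : ℂ) * spectralForm T hT g u v := by
  have h := sum_integral_eq_zero T hT ![1 / 4, -(1 / 4), -(r / 4), r / 4]
    ![u + (r : ℂ) • v, u - (r : ℂ) • v, u + v, u - v]
    (fun A => by simp [Fin.sum_univ_succ]; ring) hg hC
  simp [Fin.sum_univ_succ] at h
  simp only [spectralForm]
  push_cast
  linear_combination h

theorem spectralForm_comm (T : E →ₗ.[ℂ] E) (hT : IsSelfAdjoint T) {g : ℝ → ℂ}
    (hg : Measurable g) {C : ℝ} (hC : ∀ x, ‖g x‖ ≤ C)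
    (u v : E) : spectralForm T hT g u v = spectralForm T hT g v u := by
  have h := sum_integral_eq_zero T hT ![1 / 4, -(1 / 4), -(1 / 4), 1 / 4]
    ![u + v, u - v, v + u, v - u]
    (fun A => by simp [Fin.sum_univ_succ]; ring) hg hC
  simp [Fin.sum_univ_succ] at h
  simp only [spectralForm]
  push_cast
  linear_combination h

theorem spectralForm_I_I (T : E →ₗ.[ℂ] E) (hT : IsSelfAdjoint T) {g : ℝ → ℂ}
    (hg : Measurable g) {C : ℝ} (hC : ∀ x, ‖g x‖ ≤ C)
    (u v : E) : spectralForm T hT g (Complex.I • u) (Complex.I • v) =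
    spectralForm T hT g u v := by
  have h := sum_integral_eq_zero T hT ![1 / 4, -(1 / 4), -(1 / 4), 1 / 4]
    ![Complex.I • u + Complex.I • v, Complex.I • u - Complex.I • v, u + v, u - v]
    (fun A => by simp [Fin.sum_univ_succ]; ring) hg hC
  simp [Fin.sum_univ_succ] at h
  simp only [spectralForm]
  push_cast
  linear_combination h

theorem spectralForm_I_self (T : E →ₗ.[ℂ] E) (hT : IsSelfAdjoint T) {g : ℝ → ℂ}
    (hg : Measurable g) {C : ℝ} (hC : ∀ x, ‖g x‖ ≤ C)
    (v : E) : spectralForm T hT g v (Complex.I • v) = 0 := by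
  have h := sum_integral_eq_zero T hT ![1 / 4, -(1 / 4)]
    ![v + Complex.I • v, v - Complex.I • v]
    (fun A => by simp [Fin.sum_univ_succ]; ring) hg hC
  simp [Fin.sum_univ_succ] at h
  simp only [spectralForm]
  push_cast
  linear_combination h

theorem spectralForm_self (T : E →ₗ.[ℂ] E) (hT : IsSelfAdjoint T) {g : ℝ → ℂ}
    (hg : Measurable g) {C : ℝ} (hC : ∀ x, ‖g x‖ ≤ C)
    (v : E) :
    spectralForm T hT g v v = ∫ x, g x ∂(spectralMeasure T hT v) := by
  have h := sum_integral_eq_zero T hT ![1 / 4, -(1 / 4), -1]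
    ![v + v, v - v, v]
    (fun A => by simp [Fin.sum_univ_succ]; ring) hg hC
  simp [Fin.sum_univ_succ] at h
  simp only [spectralForm, sub_self]
  push_cast
  linear_combination h

theorem norm_spectralForm_le (T : E →ₗ.[ℂ] E) (hT : IsSelfAdjoint T) {g : ℝ → ℂ}
    (hg : Measurable g) {C : ℝ} (hC : ∀ x, ‖g x‖ ≤ C)
    (u v : E) : ‖spectralForm T hT g u v‖ ≤ C * ‖u‖ * ‖v‖ := by
  have hC0 : 0 ≤ C := (norm_nonneg _).trans (hC 0)
  have hQ : ∀ w : E, ‖∫ x, g x ∂(spectralMeasure T hT w)‖ ≤ C * ‖w‖ ^ 2 := by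
    intro w
    refine (norm_integral_le_of_norm_le_const (Filter.Eventually.of_forall hC)).trans ?_
    gcongr
    exact ENNReal.toReal_le_of_le_ofReal (by positivity) (spectralMeasure_univ_le T hT w)
  have h1 : ∀ u v : E, ‖spectralForm T hT g u v‖ ≤ C * ((‖u‖ ^ 2 + ‖v‖ ^ 2) / 2) := by
    intro u v
    have hp := parallelogram_law_with_norm ℂ u v
    rw [spectralForm, norm_mul]
    have h4 : ‖((1 / 4 : ℝ) : ℂ)‖ = 1 / 4 := by
      rw [Complex.norm_real, Real.norm_of_nonneg (by norm_num)]
    rw [h4]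
    have := (norm_sub_le (∫ x, g x ∂(spectralMeasure T hT (u + v)))
      (∫ x, g x ∂(spectralMeasure T hT (u - v)))).trans (add_le_add (hQ _) (hQ _))
    calc _ ≤ 1 / 4 * (C * ‖u + v‖ ^ 2 + C * ‖u - v‖ ^ 2) := by gcongr
      _ = C * ((‖u + v‖ ^ 2 + ‖u - v‖ ^ 2) / 4) := by ring
      _ = C * ((‖u‖ ^ 2 + ‖v‖ ^ 2) / 2) := by rw [hp]; ring
  by_cases hu : u = 0
  · have := spectralForm_smul_right T hT hg hC v 0 0
    rw [hu, spectralForm_comm T hT hg hC]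
    simp at this
    simp [this]
  by_cases hv : v = 0
  · have := spectralForm_smul_right T hT hg hC u 0 0
    rw [hv]
    simp at this
    simp [this]
  have hu' : 0 < ‖u‖ := norm_pos_iff.mpr hu
  have hv' : 0 < ‖v‖ := norm_pos_iff.mpr hv
  have h2 := h1 (((‖u‖⁻¹ : ℝ) : ℂ) • u) (((‖v‖⁻¹ : ℝ) : ℂ) • v)
  rw [spectralForm_smul_right T hT hg hC, spectralForm_comm T hT hg hC,
    spectralForm_smul_right T hT hg hC, spectralForm_comm T hT hg hC, norm_smul, norm_smul,
    norm_mul, norm_mul, Complex.norm_real, Complex.norm_real, norm_inv, norm_inv, norm_norm,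
    norm_norm, inv_mul_cancel₀ hu'.ne', inv_mul_cancel₀ hv'.ne'] at h2
  have h3 : ‖v‖⁻¹ * (‖u‖⁻¹ * ‖spectralForm T hT g u v‖) =
      ‖spectralForm T hT g u v‖ / (‖u‖ * ‖v‖) := by field_simp
  rw [h3, div_le_iff₀ (by positivity)] at h2
  linarith

theorem exists_borelCalculus (T : E →ₗ.[ℂ] E) (hT : IsSelfAdjoint T) {g : ℝ → ℂ}
    (hg : Measurable g) {C : ℝ} (hC : ∀ x, ‖g x‖ ≤ C) : ∃ A : E →L[ℂ] E, ∀ v,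
    ⟪v, A v⟫_ℂ = ∫ x, g x ∂(spectralMeasure T hT v) := by
  have hadd := spectralForm_add_right T hT hg hC
  have hsmul := spectralForm_smul_right T hT hg hC
  have hcomm := spectralForm_comm T hT hg hC
  have hII := spectralForm_I_I T hT hg hC
  have hneg : ∀ u v, spectralForm T hT g u (-v) = -spectralForm T hT g u v := fun u v => by
    have := hsmul u v (-1)
    simpa using this
  have hI : ∀ u v, spectralForm T hT g (Complex.I • u) v =
      -spectralForm T hT g u (Complex.I • v) := fun u v => by
    rw [← hII, smul_smul, Complex.I_mul_I, neg_one_smul, hcomm, hneg, hcomm]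
  have hIr : ∀ u v, spectralForm T hT g u (Complex.I • Complex.I • v) =
      -spectralForm T hT g u v := fun u v => by
    rw [smul_smul, Complex.I_mul_I, neg_one_smul, hneg]
  have hc : ∀ (c : ℂ) (v : E), c • v = (c.re : ℂ) • v + (c.im : ℂ) • (Complex.I • v) := by
    intro c v
    rw [smul_smul, ← add_smul, Complex.re_add_im]
  have hsmulc : ∀ (c : ℂ) u v, spectralForm T hT g u (c • v) =
      c.re * spectralForm T hT g u v + c.im * spectralForm T hT g u (Complex.I • v) := by
    intro c u v
    rw [hc, hadd, hsmul, hsmul]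
  have hsmull : ∀ (c : ℂ) u v, spectralForm T hT g (c • u) v =
      c.re * spectralForm T hT g u v + c.im * spectralForm T hT g (Complex.I • u) v := by
    intro c u v
    rw [hcomm, hsmulc, hcomm u, hcomm (Complex.I • u)]
  let B : E →ₗ⋆[ℂ] E →ₗ[ℂ] ℂ := LinearMap.mk₂'ₛₗ (starRingEnd ℂ) (RingHom.id ℂ)
    (fun u v => spectralForm T hT g u v - Complex.I * spectralForm T hT g u (Complex.I • v))
    (fun u u' v => by
      rw [hcomm (u + u'), hcomm (u + u'), hadd, hadd, hcomm v, hcomm v, hcomm (Complex.I • v),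
        hcomm (Complex.I • v)]
      ring)
    (fun c u v => by
      rw [hsmull c u v, hsmull c u (Complex.I • v), hI, hI, hIr]
      rw [show (starRingEnd ℂ) c = c.re - c.im * Complex.I from Complex.ext (by simp) (by simp)]
      simp only [smul_eq_mul]
      linear_combination (-c.im) * spectralForm T hT g u (Complex.I • v) * Complex.I_mul_I)
    (fun u v v' => by
      rw [smul_add, hadd, hadd]
      ring)
    (fun c u v => by
      rw [smul_comm Complex.I c v, hsmulc, hsmulc c u (Complex.I • v), hIr]
      conv_rhs => rw [← Complex.re_add_im c]
      simp only [RingHom.id_apply, smul_eq_mul]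
      linear_combination c.im * spectralForm T hT g u (Complex.I • v) * Complex.I_mul_I)
  let B' := B.mkContinuous₂ (2 * C) (fun u v => by
    change ‖spectralForm T hT g u v - Complex.I * spectralForm T hT g u (Complex.I • v)‖ ≤ _
    refine (norm_sub_le _ _).trans ?_
    rw [norm_mul, Complex.norm_I, one_mul]
    have h1 := norm_spectralForm_le T hT hg hC u v
    have h2 := norm_spectralForm_le T hT hg hC u (Complex.I • v)
    rw [norm_smul, Complex.norm_I, one_mul] at h2
    linarith)
  refine ⟨ContinuousLinearMap.adjoint (InnerProductSpace.continuousLinearMapOfBilin B'),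
    fun v => ?_⟩
  rw [ContinuousLinearMap.adjoint_inner_right,
    InnerProductSpace.continuousLinearMapOfBilin_apply]
  change spectralForm T hT g v v - Complex.I * spectralForm T hT g v (Complex.I • v) = _
  rw [spectralForm_I_self T hT hg hC, spectralForm_self T hT hg hC, mul_zero, sub_zero]


variable (T : E →ₗ.[ℂ] E) (hT : IsSelfAdjoint T)

open Classical in
/-- The operator `g(T)` for a bounded Borel function `g` on `ℝ`: the bounded operator with
`⟪v, g(T) v⟫ = ∫ g dμ_v` for all `v`. It exists by `exists_borelCalculus` and is unique because a
complex Hilbert space operator is determined by its quadratic form. -/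
def borelCalculus (g : ℝ → ℂ) : E →L[ℂ] E :=
  if h : ∃ A : E →L[ℂ] E, ∀ v, ⟪v, A v⟫_ℂ = ∫ x, g x ∂(spectralMeasure T hT v) then h.choose else 0

theorem inner_borelCalculus {g : ℝ → ℂ} (hg : Measurable g) {C : ℝ} (hC : ∀ x, ‖g x‖ ≤ C) (v : E) :
    ⟪v, borelCalculus T hT g v⟫_ℂ = ∫ x, g x ∂(spectralMeasure T hT v) := by
  have h := exists_borelCalculus T hT hg hC
  rw [borelCalculus, dif_pos h]
  exact h.choose_spec v

/-- The spectral projection `E(B) = ∫_B dE_s` of `T`, for a Borel set `B ⊆ ℝ`. -/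
def spectralProjection (B : Set ℝ) : E →L[ℂ] E := borelCalculus T hT (B.indicator fun _ => 1)

/-- The unitary group `exp(-i t T)`. -/
def evolution (t : ℝ) : E →L[ℂ] E :=
  borelCalculus T hT fun s => Complex.exp (-(Complex.I * t * s))

/-- The closed orbit `O_T(S)`: the closed span of `f(T) v`, `f ∈ C_c(ℝ)`, `v ∈ S`. -/
def orbit (S : Set E) : Submodule ℂ E :=
  (Submodule.span ℂ {w | ∃ f : C_c(ℝ, ℂ), ∃ v ∈ S, w = ccCalculus T hT f v}).topologicalClosure

/-- `K` is invariant with respect to `T` if `O_T(K) = K` (so `K` is closed). -/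
def IsInvariant (K : Submodule ℂ E) : Prop := orbit T hT K = K

/-- The closed span of the vectors `E(Δ) v` with `v ∈ S` and `Δ` in the family `D` of sets. -/
def spectralSpan (D : Set (Set ℝ)) (S : Set E) : Submodule ℂ E :=
  (Submodule.span ℂ
    {w | ∃ Δ ∈ D, ∃ v ∈ S, w = spectralProjection T hT Δ v}).topologicalClosure

/-- The eigenspace `{v ∈ dom T | T v = z v}`. -/
def eigenspace (z : ℂ) : Submodule ℂ E :=
  T.graph.comap (LinearMap.prod LinearMap.id (z • LinearMap.id))

/-- The set of eigenvalues of `T`. -/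
def eigenvalues : Set ℂ := {z | eigenspace T z ≠ ⊥}

/-- `φ` is an eigenmode of `T`, that is, an eigenvector (nonzero by definition). -/
def IsEigenmode (φ : E) : Prop := φ ≠ 0 ∧ ∃ z : ℂ, φ ∈ eigenspace T z

/-- `T` has pure point spectrum: its eigenvectors span a dense subspace. -/
def HasPurePointSpectrum : Prop := (⨆ z : ℂ, eigenspace T z).topologicalClosure = ⊤

theorem isClosed_eigenspace {T : E →ₗ.[ℂ] E} (hT : IsSelfAdjoint T) (z : ℂ) :
    IsClosed (eigenspace T z : Set E) := by
  have hcl : IsClosed (T.graph : Set (E × E)) := hT.isClosed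
  exact hcl.preimage (continuous_id.prodMk (continuous_id.const_smul z))

/-- The orthogonal projection of `E` onto the eigenspace of `T` for `z`. -/
def eigenProjection (z : ℂ) : E →L[ℂ] E :=
  have : CompleteSpace (eigenspace T z) := (isClosed_eigenspace hT z).completeSpace_coe
  (eigenspace T z).starProjection

/-- The projection of the subspace `S` onto the eigenspace for `z`. -/
def projectedEigenspace (S : Submodule ℂ E) (z : ℂ) : Submodule ℂ E :=
  S.map (eigenProjection T hT z).toLinearMap

/-- `K` is the closed orthogonal sum of the family `V`. -/
def IsClosedOrthogonalSum {ι : Type*} (K : Submodule ℂ E) (V : ι → Submodule ℂ E) : Prop :=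
  (∀ i j, i ≠ j → V i ⟂ V j) ∧ K = (⨆ i, V i).topologicalClosure

end Calculus

/-- The intervals of `ℝ`, of any kind. -/
def intervals : Set (Set ℝ) := {Δ | Δ.OrdConnected}

/-- The intervals of `ℝ` that are contained in an interval of length `ε`. -/
def intervalsOfLength (ε : ℝ) : Set (Set ℝ) :=
  {Δ | Δ.OrdConnected ∧ ∃ c : ℝ, Δ ⊆ Set.Icc c (c + ε)}

section Systems

/-- The friction function `a(t) = Γ exp(-i t Ω₂) Γ†` of the open system that is obtained by
projecting the conservative system with coupling `Γ : H₂ → H₁` and hidden dynamics `Ω₂` to `H₁`. -/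
def frictionFunction {H₁ H₂ : Type*} [NormedAddCommGroup H₁] [InnerProductSpace ℂ H₁]
    [CompleteSpace H₁] [NormedAddCommGroup H₂] [InnerProductSpace ℂ H₂] [CompleteSpace H₂]
    (Ω₂ : H₂ →ₗ.[ℂ] H₂) (hΩ₂ : IsSelfAdjoint Ω₂) (Γ : H₂ →L[ℂ] H₁) (t : ℝ) : H₁ →L[ℂ] H₁ :=
  Γ ∘L evolution Ω₂ hΩ₂ t ∘L ContinuousLinearMap.adjoint Γ

/-- `(H₂, Ω₂, Γ)` is a minimal triple for the friction function `a` on `H₁`: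
`a(t) = Γ exp(-i t Ω₂) Γ†` for `t ≥ 0`, and the span of `f(Ω₂) Γ† v`, `f ∈ C_c(ℝ)`, `v ∈ H₁`,
is dense in `H₂`. -/
structure IsMinimalTriple {H₁ H₂ : Type*} [NormedAddCommGroup H₁] [InnerProductSpace ℂ H₁]
    [CompleteSpace H₁] [NormedAddCommGroup H₂] [InnerProductSpace ℂ H₂] [CompleteSpace H₂]
    (a : ℝ → H₁ →L[ℂ] H₁) (Ω₂ : H₂ →ₗ.[ℂ] H₂) (hΩ₂ : IsSelfAdjoint Ω₂) (Γ : H₂ →L[ℂ] H₁) :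
    Prop where
  friction : ∀ t, 0 ≤ t → a t = frictionFunction Ω₂ hΩ₂ Γ t
  minimal : orbit Ω₂ hΩ₂ (Set.range (ContinuousLinearMap.adjoint Γ)) = ⊤

variable {H : Type*} [NormedAddCommGroup H] [InnerProductSpace ℂ H] [CompleteSpace H]

/-- The restriction of the operator `T` to the subspace `K` (with domain `K ∩ dom T`) is the block
operator `[[TA, G], [G†, TB]]` with respect to `A ⊕ B`, on its natural domain `dom TA ⊕ dom TB`. -/
def HasBlockForm (T : H →ₗ.[ℂ] H) (K A B : Submodule ℂ H) [CompleteSpace A] [CompleteSpace B]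
    (TA : A →ₗ.[ℂ] A) (TB : B →ₗ.[ℂ] B) (G : B →L[ℂ] A) : Prop :=
  ∀ x y : H, (x ∈ K ∧ (x, y) ∈ T.graph) ↔
    ∃ (a : TA.domain) (b : TB.domain), x = ((a : A) : H) + ((b : B) : H) ∧
      y = ((TA a + G b : A) : H) + ((ContinuousLinearMap.adjoint G a + TB b : B) : H)

/-- The subsystem `(K, Ω restricted to K)` of the conservative system `(H, Ω)` is the minimal
conservative extension of the open system `(H₁, Ω₁, a)`, for the subspace `H₁` of `H`: `K` is
`Ω`-invariant, and `K = H₁ ⊕ H₂'` is an orthogonal sum with respect to which `Ω` restricted to `K`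
is the block operator `[[Ω₁, Γ'], [Γ'†, Ω₂']]` where `(H₂', Ω₂', Γ')` is a minimal triple
for `a`. -/
def IsMinimalExtensionIn (Ω : H →ₗ.[ℂ] H) (hΩ : IsSelfAdjoint Ω) (H₁ : Submodule ℂ H)
    [CompleteSpace H₁] (Ω₁ : H₁ →ₗ.[ℂ] H₁) (a : ℝ → H₁ →L[ℂ] H₁) (K : Submodule ℂ H) : Prop :=
  IsInvariant Ω hΩ K ∧
  ∃ (H₂' : Submodule ℂ H) (_ : CompleteSpace H₂') (Ω₂' : H₂' →ₗ.[ℂ] H₂')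
    (hΩ₂' : IsSelfAdjoint Ω₂') (Γ' : H₂' →L[ℂ] H₁),
    H₂' ≤ H₁ᗮ ∧ K = H₁ ⊔ H₂' ∧ HasBlockForm Ω K H₁ H₂' Ω₁ Ω₂' Γ' ∧
      IsMinimalTriple a Ω₂' hΩ₂' Γ'

/-- The conservative system `(H = H₁ ⊕ H₂, Ω)` is reconstructible: it is the minimal conservative
extension of each of the two open systems `(H₁, Ω₁, Γ exp(-i t Ω₂) Γ†)` and
`(H₂, Ω₂, Γ† exp(-i t Ω₁) Γ)`. -/
def IsReconstructible (Ω : H →ₗ.[ℂ] H) (hΩ : IsSelfAdjoint Ω) (H₁ : Submodule ℂ H)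
    [CompleteSpace H₁] (Ω₁ : H₁ →ₗ.[ℂ] H₁) (hΩ₁ : IsSelfAdjoint Ω₁)
    (Ω₂ : H₁ᗮ →ₗ.[ℂ] H₁ᗮ) (hΩ₂ : IsSelfAdjoint Ω₂) (Γ : H₁ᗮ →L[ℂ] H₁) : Prop :=
  IsMinimalExtensionIn Ω hΩ H₁ Ω₁ (frictionFunction Ω₂ hΩ₂ Γ) ⊤ ∧
  IsMinimalExtensionIn Ω hΩ H₁ᗮ Ω₂
    (frictionFunction Ω₁ hΩ₁ (ContinuousLinearMap.adjoint Γ)) ⊤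

/-- The off-diagonal coupling operator `[[0, Γ], [Γ†, 0]]` on `H = H₁ ⊕ H₁ᗮ`. -/
def couplingOperator (H₁ : Submodule ℂ H) [CompleteSpace H₁] (Γ : H₁ᗮ →L[ℂ] H₁) : H →L[ℂ] H :=
  H₁.subtypeL ∘L Γ ∘L H₁ᗮ.orthogonalProjectionOnto +
    H₁ᗮ.subtypeL ∘L ContinuousLinearMap.adjoint Γ ∘L H₁.orthogonalProjectionOnto

/-- `H₁` contains no nontrivial (that is, nonzero) `Ω`-invariant subspace. -/
def HasNoInvariantSubspace (Ω : H →ₗ.[ℂ] H) (hΩ : IsSelfAdjoint Ω) (H₁ : Submodule ℂ H) : Prop :=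
  ∀ K : Submodule ℂ H, K ≤ H₁ → IsInvariant Ω hΩ K → K = ⊥

end Systems
end OpenSystems
end

open OpenSystems

/-!
The Cayley transform `U` of the self-adjoint operator `T` turns statements about `T` into
statements about a bounded operator: every function of `T` is a function of `U`, and the closed
subspaces invariant under `T` are exactly those that reduce the unitary `U`. Since functions of `T`
with compact support separate points, the orbit of `S` is the smallest reducing subspace
containing `S`.

A minimal extension of the open system on `H₁` is a reducing subspace containing `H₁`. Its
hidden part has no proper reducing subspace that contains the range of `Γ†`, so it is the smallest
one, the orbit of `H₁`. Conversely, compressing the hidden dynamics to the orbit of the range of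
`Γ†` changes neither the friction function nor the block form. Spectral projections of short
intervals and, for a pure point spectrum, eigenprojections generate the same reducing subspace,
because they are functions of `T` and a vector that all of them annihilate is zero.

Finally, the complement of the orbit of the range of the coupling is a reducing subspace on which
the coupling vanishes. There `T` commutes with the projection to `H₁`, which maps this complement
to an invariant subspace of `H₁`; the same observation for an eigenvector splits an eigenmode
killed by the coupling into one in `H₁` and one in the complement of `H₁`.
-/

namespace OpenSystems

open scoped InnerProductSpace CompactlySupported
open MeasureTheory
open ContinuousLinearMap (adjoint)
open Module.End (invtSubmodule)

section Intertwining

variable {E F : Type*} [NormedAddCommGroup E] [InnerProductSpace ℂ E] [CompleteSpace E]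
  [NormedAddCommGroup F] [InnerProductSpace ℂ F] [CompleteSpace F]

theorem cayley_apply_eq_iff (T : E →ₗ.[ℂ] E) (hT : IsSelfAdjoint T) (x y : E) :
    (cayley T hT : E →L[ℂ] E) (y + Complex.I • x) = y - Complex.I • x ↔ (x, y) ∈ T.graph := by
  refine ⟨fun h => ?_, cayley_spec T hT⟩
  obtain ⟨x', y', hxy', hsum⟩ :=
    surjective_add_smul hT Complex.I (Or.inl rfl) (y + Complex.I • x)
  have hdiff : y - Complex.I • x = y' - Complex.I • x' := by
    rw [← h, ← hsum, cayley_spec T hT hxy']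
  obtain rfl : y = y' := by
    linear_combination (norm := module) (1 / 2 : ℂ) • hdiff - (1 / 2 : ℂ) • hsum
  obtain rfl : x = x' := (smul_right_injective E Complex.I_ne_zero (add_left_cancel hsum)).symm
  exact hxy'

theorem eq_zero_of_cayley_apply_eq_self {T : E →ₗ.[ℂ] E} {hT : IsSelfAdjoint T} {u : E}
    (h : (cayley T hT : E →L[ℂ] E) u = u) : u = 0 := by
  have hu : ((0 : E), u) ∈ T.graph := by
    rw [← cayley_apply_eq_iff T hT]
    simpa using h
  exact T.graph_fst_eq_zero_snd hu rfl

theorem semiconj_cayley {T : E →ₗ.[ℂ] E} (hT : IsSelfAdjoint T) {S : F →ₗ.[ℂ] F}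
    (hS : IsSelfAdjoint S) {J : F →L[ℂ] E}
    (h : ∀ x y, (x, y) ∈ S.graph → (J x, J y) ∈ T.graph) :
    Function.Semiconj J (cayley S hS : F →L[ℂ] F) (cayley T hT : E →L[ℂ] E) := by
  intro z
  obtain ⟨x, y, hxy, rfl⟩ := surjective_add_smul hS Complex.I (Or.inl rfl) z
  rw [cayley_spec S hS hxy, map_sub, map_add, map_smul, cayley_spec T hT (h x y hxy)]

theorem unitary_apply_adjoint_apply (V : unitary (E →L[ℂ] E)) (x : E) :
    (V : E →L[ℂ] E) (adjoint (V : E →L[ℂ] E) x) = x :=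
  DFunLike.congr_fun (Unitary.mul_star_self_of_mem V.2) x

theorem unitary_adjoint_apply_apply (V : unitary (E →L[ℂ] E)) (x : E) :
    adjoint (V : E →L[ℂ] E) ((V : E →L[ℂ] E) x) = x :=
  DFunLike.congr_fun (Unitary.star_mul_self_of_mem V.2) x

theorem semiconj_adjoint_of_unitary {V : unitary (E →L[ℂ] E)} {W : unitary (F →L[ℂ] F)}
    {J : F → E} (h : Function.Semiconj J (W : F →L[ℂ] F) (V : E →L[ℂ] E)) :
    Function.Semiconj J (adjoint (W : F →L[ℂ] F)) (adjoint (V : E →L[ℂ] E)) := fun x => by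
  rw [← unitary_adjoint_apply_apply V (J _), ← h.eq, unitary_apply_adjoint_apply]

theorem semiconj_cfcHomSuperset {a : E →L[ℂ] E} {b : F →L[ℂ] F} (ha : IsStarNormal a)
    (hb : IsStarNormal b) {J : F →L[ℂ] E} (h : Function.Semiconj J b a)
    (h' : Function.Semiconj J (adjoint b) (adjoint a)) {s : Set ℂ} [CompactSpace s]
    (has : spectrum ℂ a ⊆ s) (hbs : spectrum ℂ b ⊆ s) (f : C(s, ℂ)) :
    Function.Semiconj J (cfcHomSuperset hb hbs f) (cfcHomSuperset ha has f) := by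
  induction f using ContinuousMap.induction_on_of_compact with
  | const r =>
    intro x
    have hr : ContinuousMap.const s r = algebraMap ℂ _ r := rfl
    rw [hr, AlgHomClass.commutes, AlgHomClass.commutes]
    simp only [Algebra.algebraMap_eq_smul_one, smul_apply, one_apply_eq_self, map_smul]
  | id => rwa [cfcHomSuperset_id, cfcHomSuperset_id]
  | star_id =>
    rwa [map_star, map_star, cfcHomSuperset_id, cfcHomSuperset_id]
  | add f g hf hg =>
    intro x
    simp only [map_add, add_apply, hf.eq, hg.eq]
  | mul f g hf hg =>
    rw [map_mul, map_mul]
    exact hf.comp_right hg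
  | frequently f hf =>
    intro x
    refine (hf.mono fun g hg => hg x).mem_of_closed (isClosed_eq ?_ ?_)
    · exact J.continuous.comp ((cfcHomSuperset_continuous hb hbs).clm_apply continuous_const)
    · exact (cfcHomSuperset_continuous ha has).clm_apply continuous_const

theorem semiconj_cfc {a : E →L[ℂ] E} {b : F →L[ℂ] F} (ha : IsStarNormal a)
    (hb : IsStarNormal b) {J : F →L[ℂ] E} (h : Function.Semiconj J b a)
    (h' : Function.Semiconj J (adjoint b) (adjoint a)) {f : ℂ → ℂ}
    (hf : ContinuousOn f (spectrum ℂ a ∪ spectrum ℂ b)) :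
    Function.Semiconj J (cfc f b : F →L[ℂ] F) (cfc f a : E →L[ℂ] E) := by
  have : CompactSpace ↑(spectrum ℂ a ∪ spectrum ℂ b) := isCompact_iff_compactSpace.mp
    ((spectrum.isCompact a).union (spectrum.isCompact b))
  rw [cfc_apply f a ha (hf.mono Set.subset_union_left),
    cfc_apply f b hb (hf.mono Set.subset_union_right)]
  exact semiconj_cfcHomSuperset ha hb h h' Set.subset_union_left Set.subset_union_right
    ⟨_, hf.domRestrict⟩

variable {T : E →ₗ.[ℂ] E} {hT : IsSelfAdjoint T} {S : F →ₗ.[ℂ] F} {hS : IsSelfAdjoint S}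

theorem semiconj_ccCalculus {J : F →L[ℂ] E}
    (h : Function.Semiconj J (cayley S hS : F →L[ℂ] F) (cayley T hT : E →L[ℂ] E))
    (f : C_c(ℝ, ℂ)) : Function.Semiconj J (ccCalculus S hS f) (ccCalculus T hT f) :=
  semiconj_cfc inferInstance inferInstance h (semiconj_adjoint_of_unitary h)
    ((continuousOn_circleFun f).mono (Set.union_subset
      (spectrum.subset_circle_of_unitary (cayley T hT).2)
      (spectrum.subset_circle_of_unitary (cayley S hS).2)))

theorem spectralMeasure_map {J : F →ₗᵢ[ℂ] E}
    (h : Function.Semiconj J (cayley S hS : F →L[ℂ] F) (cayley T hT : E →L[ℂ] E)) (v : F) :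
    spectralMeasure T hT (J v) = spectralMeasure S hS v :=
  Measure.ext_of_integral_eq_on_compactlySupported fun f => by
    have hf : J (ccCalculus S hS (toComplex f) v) = ccCalculus T hT (toComplex f) (J v) :=
      semiconj_ccCalculus (J := J.toContinuousLinearMap) h (toComplex f) v
    rw [integral_spectralMeasure, integral_spectralMeasure, ← hf, J.inner_map_map]

theorem borelCalculus_compression {J : F →ₗᵢ[ℂ] E}
    (h : Function.Semiconj J (cayley S hS : F →L[ℂ] F) (cayley T hT : E →L[ℂ] E))
    {g : ℝ → ℂ} (hg : Measurable g) {C : ℝ} (hC : ∀ x, ‖g x‖ ≤ C) :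
    adjoint J.toContinuousLinearMap ∘L borelCalculus T hT g ∘L J.toContinuousLinearMap =
      borelCalculus S hS g := by
  refine ContinuousLinearMap.coe_injective ((ext_inner_map _ _).mp fun x => ?_)
  refine (starRingEnd ℂ).injective ?_
  rw [inner_conj_symm, inner_conj_symm]
  calc ⟪x, adjoint J.toContinuousLinearMap (borelCalculus T hT g (J x))⟫_ℂ
      = ⟪J x, borelCalculus T hT g (J x)⟫_ℂ := ContinuousLinearMap.adjoint_inner_right _ _ _
    _ = ⟪x, borelCalculus S hS g x⟫_ℂ := by
      rw [inner_borelCalculus T hT hg hC, inner_borelCalculus S hS hg hC, spectralMeasure_map h]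

theorem evolution_compression {J : F →ₗᵢ[ℂ] E}
    (h : Function.Semiconj J (cayley S hS : F →L[ℂ] F) (cayley T hT : E →L[ℂ] E)) (t : ℝ) :
    adjoint J.toContinuousLinearMap ∘L evolution T hT t ∘L J.toContinuousLinearMap =
      evolution S hS t := by
  refine borelCalculus_compression h (C := 1) (by fun_prop) fun s => ?_
  rw [show -(Complex.I * t * s) = ((-(t * s) : ℝ) : ℂ) * Complex.I by push_cast; ring,
    Complex.norm_exp_ofReal_mul_I]

end Intertwining

section Reducing

variable {𝕜 E : Type*} [RCLike 𝕜] [NormedAddCommGroup E] [InnerProductSpace 𝕜 E] [CompleteSpace E]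
  {A : E →L[𝕜] E} {K : Submodule 𝕜 E}

/-- The closed subspace `K` reduces the bounded operator `A`: it is invariant under `A` and under
its adjoint, so that `A` is block diagonal with respect to `K ⊕ Kᗮ`. -/
structure Reduces (A : E →L[𝕜] E) (K : Submodule 𝕜 E) : Prop where
  isClosed : IsClosed (K : Set E)
  mem_invtSubmodule : K ∈ invtSubmodule (A : E →ₗ[𝕜] E)
  mem_invtSubmodule_adjoint : K ∈ invtSubmodule (adjoint A : E →ₗ[𝕜] E)

theorem Reduces.orthogonal (h : Reduces A K) : Reduces A Kᗮ where
  isClosed := K.isClosed_orthogonal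
  mem_invtSubmodule :=
    ContinuousLinearMap.orthogonal_mem_invtSubmodule h.mem_invtSubmodule_adjoint
  mem_invtSubmodule_adjoint := ContinuousLinearMap.orthogonal_mem_invtSubmodule <| by
    rw [ContinuousLinearMap.adjoint_adjoint]
    exact h.mem_invtSubmodule

omit [CompleteSpace E] in
theorem topologicalClosure_mem_invtSubmodule (h : K ∈ invtSubmodule (A : E →ₗ[𝕜] E)) :
    K.topologicalClosure ∈ invtSubmodule (A : E →ₗ[𝕜] E) :=
  K.topologicalClosure_minimal (h.trans (Submodule.comap_mono K.le_topologicalClosure))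
    (K.isClosed_topologicalClosure.preimage A.continuous)

theorem reduces_topologicalClosure (h : K ∈ invtSubmodule (A : E →ₗ[𝕜] E))
    (h' : K ∈ invtSubmodule (adjoint A : E →ₗ[𝕜] E)) : Reduces A K.topologicalClosure where
  isClosed := K.isClosed_topologicalClosure
  mem_invtSubmodule := topologicalClosure_mem_invtSubmodule h
  mem_invtSubmodule_adjoint := topologicalClosure_mem_invtSubmodule h'

theorem reduces_iff_commute [CompleteSpace K] : Reduces A K ↔ Commute K.starProjection A := by
  have hP : IsIdempotentElem K.starProjection := K.isIdempotentElem_starProjection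
  have hcomm (B : E →L[𝕜] E) : Commute K.starProjection B ↔
      K ∈ invtSubmodule (B : E →ₗ[𝕜] E) ∧ Kᗮ ∈ invtSubmodule (B : E →ₗ[𝕜] E) := by
    rw [ContinuousLinearMap.IsIdempotentElem.commute_iff hP, K.range_starProjection,
      K.ker_starProjection]
  refine ⟨fun h => (hcomm A).2 ⟨h.mem_invtSubmodule, h.orthogonal.mem_invtSubmodule⟩, fun h => ?_⟩
  have h' : Commute K.starProjection (adjoint A) := by
    simpa using! (isSelfAdjoint_starProjection K).star_eq ▸ h.star_star
  exact ⟨(completeSpace_coe_iff_isComplete.mp ‹_›).isClosed, ((hcomm A).1 h).1, ((hcomm _).1 h').1⟩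

theorem Reduces.semiconj_starProjection [CompleteSpace K] (h : Reduces A K) :
    Function.Semiconj K.starProjection A A :=
  DFunLike.congr_fun (reduces_iff_commute.1 h).eq

end Reducing

section ReducingCayley

variable {E : Type*} [NormedAddCommGroup E] [InnerProductSpace ℂ E] [CompleteSpace E]
  {T : E →ₗ.[ℂ] E} {hT : IsSelfAdjoint T} {K : Submodule ℂ E}

theorem Reduces.starProjection_mem_graph [CompleteSpace K]
    (h : Reduces (cayley T hT : E →L[ℂ] E) K) {x y : E} (hxy : (x, y) ∈ T.graph) :
    (K.starProjection x, K.starProjection y) ∈ T.graph := by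
  rw [← cayley_apply_eq_iff T hT, ← map_smul, ← map_add, ← map_sub,
    ← h.semiconj_starProjection.eq, cayley_spec T hT hxy]

theorem Reduces.mem_of_mem_graph (h : Reduces (cayley T hT : E →L[ℂ] E) K) {x y : E}
    (hx : x ∈ K) (hxy : (x, y) ∈ T.graph) : y ∈ K := by
  have : CompleteSpace K := h.isClosed.completeSpace_coe
  have hPxy := h.starProjection_mem_graph hxy
  rw [K.starProjection_eq_self_iff.mpr hx] at hPxy
  exact K.starProjection_eq_self_iff.mp (T.mem_graph_snd_inj hxy hPxy rfl).symm

theorem reduces_of_starProjection_mem_graph [CompleteSpace K]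
    (h : ∀ x y, (x, y) ∈ T.graph → (K.starProjection x, K.starProjection y) ∈ T.graph) :
    Reduces (cayley T hT : E →L[ℂ] E) K :=
  reduces_iff_commute.2 (ContinuousLinearMap.ext (semiconj_cayley hT hT h))

theorem Reduces.ccCalculus_mem (h : Reduces (cayley T hT : E →L[ℂ] E) K) (f : C_c(ℝ, ℂ)) {x : E}
    (hx : x ∈ K) : ccCalculus T hT f x ∈ K := by
  have : CompleteSpace K := h.isClosed.completeSpace_coe
  rw [← K.starProjection_eq_self_iff,
    (semiconj_ccCalculus h.semiconj_starProjection f).eq, K.starProjection_eq_self_iff.mpr hx]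

theorem Reduces.orbit_le (h : Reduces (cayley T hT : E →L[ℂ] E) K) {S : Set E} (hS : S ⊆ K) :
    orbit T hT S ≤ K := by
  refine Submodule.topologicalClosure_minimal _ (Submodule.span_le.mpr ?_) h.isClosed
  rintro _ ⟨f, v, hv, rfl⟩
  exact h.ccCalculus_mem f (hS hv)

end ReducingCayley

section Orbit

variable {E : Type*} [NormedAddCommGroup E] [InnerProductSpace ℂ E] [CompleteSpace E]
  {T : E →ₗ.[ℂ] E} {hT : IsSelfAdjoint T}

theorem inverseCayley_add_I_mul {z : ℂ} (hz : z ∈ Metric.sphere (0 : ℂ) 1) (h1 : z ≠ 1) :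
    (((Complex.I * (1 + z) / (1 - z)).re : ℝ) + Complex.I) * (1 - z) = 2 * Complex.I := by
  have hd : 1 - z ≠ 0 := sub_ne_zero.mpr h1.symm
  have hreal : (((Complex.I * (1 + z) / (1 - z)).re : ℝ) : ℂ) = Complex.I * (1 + z) / (1 - z) := by
    have hconj : (starRingEnd ℂ) z = z⁻¹ := (Complex.inv_eq_conj (by simpa using hz)).symm
    have hz0 : z ≠ 0 := by
      rintro rfl
      simp at hz
    have hd' : z - 1 ≠ 0 := sub_ne_zero.mpr h1
    rw [← Complex.conj_eq_iff_re]
    simp only [map_div₀, map_mul, map_add, map_sub, Complex.conj_I, map_one, hconj]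
    field_simp
    ring
  rw [hreal]
  field_simp
  ring

theorem ofReal_add_I_ne_zero (s : ℝ) : (s : ℂ) + Complex.I ≠ 0 := fun h => by
  simpa using congrArg Complex.im h

theorem cayley_mul_ccCalculus (f : C_c(ℝ, ℂ)) : ∃ g : C_c(ℝ, ℂ),
    (cayley T hT : E →L[ℂ] E) * ccCalculus T hT f = ccCalculus T hT g := by
  let h : C(ℝ, ℂ) := ⟨fun s => (s - Complex.I) / (s + Complex.I),
    Continuous.div (by fun_prop) (by fun_prop) ofReal_add_I_ne_zero⟩
  refine ⟨h • f, ?_⟩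
  have hU : cfc (fun z : ℂ => z) (cayley T hT : E →L[ℂ] E) = cayley T hT := cfc_id' ℂ _
  rw [ccCalculus, ccCalculus]
  nth_rw 1 [← hU]
  rw [← cfc_mul (fun z => z) _ _ (by fun_prop) (continuousOn_spectrum T hT f)]
  refine cfc_congr fun z hz => ?_
  by_cases h1 : z = 1
  · simp [circleFun, h1]
  have hs := inverseCayley_add_I_mul (spectrum.subset_circle_of_unitary (cayley T hT).2 hz) h1
  simp only [circleFun, h1, if_false]
  set s := (Complex.I * (1 + z) / (1 - z)).re
  change z * f s = (s - Complex.I) / (s + Complex.I) * f s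
  rw [div_mul_eq_mul_div, eq_div_iff (ofReal_add_I_ne_zero s)]
  linear_combination -f s * hs

theorem star_ccCalculus (f : C_c(ℝ, ℂ)) :
    star (ccCalculus T hT f) = ccCalculus T hT (star f : C_c(ℝ, ℂ)) := by
  rw [ccCalculus, ccCalculus, ← cfc_star]
  refine cfc_congr fun z _ => ?_
  by_cases h1 : z = 1 <;> simp [circleFun, h1]

theorem commute_cayley_ccCalculus (f : ℝ → ℂ) :
    Commute (cayley T hT : E →L[ℂ] E) (ccCalculus T hT f) :=
  ((Commute.refl _).cfc (star_comm_self' _) (circleFun f)).symm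

theorem star_cayley_mul_ccCalculus (f : C_c(ℝ, ℂ)) : ∃ g : C_c(ℝ, ℂ),
    star (cayley T hT : E →L[ℂ] E) * ccCalculus T hT f = ccCalculus T hT g := by
  obtain ⟨g, hg⟩ := cayley_mul_ccCalculus (T := T) (hT := hT) (star f)
  refine ⟨star g, ?_⟩
  rw [← star_ccCalculus, ← hg, (commute_cayley_ccCalculus _).eq, star_mul, star_ccCalculus,
    star_star]

theorem reduces_orbit (S : Set E) : Reduces (cayley T hT : E →L[ℂ] E) (orbit T hT S) := by
  refine reduces_topologicalClosure ?_ ?_ <;> refine Submodule.span_le.mpr ?_ <;>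
    rintro _ ⟨f, v, hv, rfl⟩
  · obtain ⟨g, hg⟩ := cayley_mul_ccCalculus (T := T) (hT := hT) f
    exact Submodule.subset_span ⟨g, v, hv, DFunLike.congr_fun hg v⟩
  · obtain ⟨g, hg⟩ := star_cayley_mul_ccCalculus (T := T) (hT := hT) f
    exact Submodule.subset_span ⟨g, v, hv, DFunLike.congr_fun hg v⟩

instance (S : Set E) : CompleteSpace (orbit T hT S) :=
  Submodule.topologicalClosure.completeSpace _

theorem norm_sub_one_le_two_div {z : ℂ} (hz : z ∈ Metric.sphere (0 : ℂ) 1) {r : ℝ} (hr : 0 < r)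
    (h : r ≤ |(Complex.I * (1 + z) / (1 - z)).re|) : ‖z - 1‖ ≤ 2 / r := by
  have h1 : z ≠ 1 := by
    rintro rfl
    simp [hr.not_ge] at h
  have hmul := congrArg norm (inverseCayley_add_I_mul hz h1)
  set s := (Complex.I * (1 + z) / (1 - z)).re
  have hs : |s| ≤ ‖(s : ℂ) + Complex.I‖ := by
    simpa using Complex.abs_re_le_norm ((s : ℂ) + Complex.I)
  rw [le_div_iff₀' hr, norm_sub_rev]
  calc r * ‖1 - z‖ ≤ ‖(s : ℂ) + Complex.I‖ * ‖1 - z‖ := by gcongr; exact h.trans hs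
    _ = 2 := by simpa using hmul

-- The factor `z - 1` vanishes at the point `1` of the circle, which the Cayley transform puts at
-- infinity, so a cutoff on a large interval suffices.
theorem exists_norm_sub_one_mul_one_sub_circleFun_le {ε : ℝ} (hε : 0 < ε) : ∃ f : C_c(ℝ, ℂ),
    ∀ z ∈ Metric.sphere (0 : ℂ) 1, ‖(z - 1) * (1 - circleFun f z)‖ ≤ ε := by
  obtain ⟨f, hf_one, hf_supp, -, hf_mem⟩ := exists_continuousMap_one_of_isCompact_subset_isOpen
    (isCompact_closedBall (0 : ℝ) (2 / ε)) isOpen_univ (Set.subset_univ _)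
  refine ⟨toComplex ⟨f, hf_supp⟩, fun z hz => ?_⟩
  by_cases h1 : z = 1
  · simp [h1, hε.le]
  simp only [circleFun, h1, if_false, toComplex_apply]
  set s := (Complex.I * (1 + z) / (1 - z)).re
  change ‖(z - 1) * (1 - (f s : ℂ))‖ ≤ ε
  by_cases hs : s ∈ Metric.closedBall (0 : ℝ) (2 / ε)
  · simp [show f s = 1 from hf_one hs, hε.le]
  have hz_near : ‖z - 1‖ ≤ ε := by
    have hs' : 2 / ε ≤ |s| := (show 2 / ε < |s| by simpa using hs).le
    simpa using norm_sub_one_le_two_div hz (by positivity) hs'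
  have hcut : ‖(1 : ℂ) - f s‖ ≤ 1 := by
    rw [← Complex.ofReal_one, ← Complex.ofReal_sub, Complex.norm_real, Real.norm_eq_abs, abs_le]
    have hfs : 0 ≤ f s ∧ f s ≤ 1 := hf_mem s
    constructor <;> linarith
  calc ‖(z - 1) * (1 - (f s : ℂ))‖ = ‖z - 1‖ * ‖1 - (f s : ℂ)‖ := norm_mul _ _
    _ ≤ ε * 1 := by gcongr
    _ = ε := mul_one _

theorem exists_norm_cayley_sub_one_mul_one_sub_ccCalculus_le {ε : ℝ} (hε : 0 < ε) :
    ∃ f : C_c(ℝ, ℂ), ‖((cayley T hT : E →L[ℂ] E) - 1) * (1 - ccCalculus T hT f)‖ ≤ ε := by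
  obtain ⟨f, hf⟩ := exists_norm_sub_one_mul_one_sub_circleFun_le hε
  refine ⟨f, ?_⟩
  have hcont := continuousOn_spectrum T hT f
  have hcfc : cfc (fun z => (z - 1) * (1 - circleFun f z)) (cayley T hT : E →L[ℂ] E) =
      ((cayley T hT : E →L[ℂ] E) - 1) * (1 - ccCalculus T hT f) := by
    rw [cfc_mul (fun z => z - 1) (fun z => 1 - circleFun f z) _ (by fun_prop)
      (continuousOn_const.sub hcont), cfc_sub _ _ _ (by fun_prop) (by fun_prop),
      cfc_sub _ _ _ (by fun_prop) hcont, cfc_id' ℂ _,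
      cfc_const_one ℂ _, ccCalculus]
  rw [← hcfc]
  exact norm_cfc_le hε.le fun z hz => hf z (spectrum.subset_circle_of_unitary (cayley T hT).2 hz)

theorem eq_zero_of_forall_ccCalculus_eq_zero {u : E}
    (h : ∀ f : C_c(ℝ, ℂ), ccCalculus T hT f u = 0) : u = 0 := by
  have hbound (ε : ℝ) (hε : 0 < ε) : ‖(cayley T hT : E →L[ℂ] E) u - u‖ ≤ ε * ‖u‖ := by
    obtain ⟨f, hf⟩ :=
      exists_norm_cayley_sub_one_mul_one_sub_ccCalculus_le (T := T) (hT := hT) hε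
    simpa [h f] using ContinuousLinearMap.le_of_opNorm_le _ hf u
  have hzero : ‖(cayley T hT : E →L[ℂ] E) u - u‖ ≤ 0 * ‖u‖ :=
    ge_of_tendsto ((continuous_mul_const ‖u‖).continuousWithinAt (s := Set.Ioi 0) (x := 0))
      (eventually_mem_nhdsWithin.mono hbound)
  rw [zero_mul] at hzero
  exact eq_zero_of_cayley_apply_eq_self (sub_eq_zero.mp (norm_le_zero_iff.mp hzero))

theorem subset_orbit (S : Set E) : S ⊆ orbit T hT S := by
  intro v hv
  have hreduces := reduces_orbit (T := T) (hT := hT) S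
  rw [SetLike.mem_coe, ← Submodule.starProjection_eq_self_iff, eq_comm, ← sub_eq_zero]
  refine eq_zero_of_forall_ccCalculus_eq_zero (T := T) (hT := hT) fun f => ?_
  rw [map_sub, ← (semiconj_ccCalculus hreduces.semiconj_starProjection f).eq, sub_eq_zero, eq_comm,
    Submodule.starProjection_eq_self_iff]
  exact Submodule.le_topologicalClosure _ (Submodule.subset_span ⟨f, v, hv, rfl⟩)

theorem isInvariant_iff_reduces {K : Submodule ℂ E} :
    IsInvariant T hT K ↔ Reduces (cayley T hT : E →L[ℂ] E) K := by
  refine ⟨fun h => ?_, fun h => le_antisymm (h.orbit_le subset_rfl) (subset_orbit _)⟩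
  rw [IsInvariant] at h
  rw [← h]
  exact reduces_orbit _

theorem Reduces.le_orthogonal_orbit {K : Submodule ℂ E}
    (h : Reduces (cayley T hT : E →L[ℂ] E) K) {S : Set E} (hS : S ⊆ Kᗮ) :
    K ≤ (orbit T hT S)ᗮ :=
  Submodule.IsOrtho.symm (h.orthogonal.orbit_le hS)

end Orbit

section SpectralSpan

variable {E : Type*} [NormedAddCommGroup E] [InnerProductSpace ℂ E]

theorem four_mul_inner_apply (A : E →L[ℂ] E) (w v : E) : 4 * ⟪w, A v⟫_ℂ =
    ⟪w + v, A (w + v)⟫_ℂ - ⟪w - v, A (w - v)⟫_ℂ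
      - Complex.I * (⟪w + Complex.I • v, A (w + Complex.I • v)⟫_ℂ
        - ⟪w - Complex.I • v, A (w - Complex.I • v)⟫_ℂ) := by
  simp only [map_add, map_sub, map_smul, inner_add_left, inner_add_right, inner_sub_left,
    inner_sub_right, inner_smul_left, inner_smul_right, Complex.conj_I]
  linear_combination (2 * ⟪w, A v⟫_ℂ - 2 * ⟪v, A w⟫_ℂ) * Complex.I_mul_I

theorem measure_eq_of_short_Ioc {μ ν : Measure ℝ} [IsFiniteMeasure μ] {ε : ℝ}
    (hε : 0 < ε) (h : ∀ a b, b ≤ a + ε → μ (Set.Ioc a b) = ν (Set.Ioc a b)) : μ = ν := by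
  refine Measure.ext_of_iUnion_eq_univ (iUnion_Ioc_zsmul hε) fun n => ?_
  refine Measure.ext_of_Ioc _ _ fun a b _ => ?_
  rw [Measure.restrict_apply measurableSet_Ioc, Measure.restrict_apply measurableSet_Ioc,
    Set.Ioc_inter_Ioc]
  refine h _ _ ?_
  calc min b ((n + 1) • ε) ≤ n • ε + ε := (min_le_right _ _).trans_eq (add_one_zsmul ε n)
    _ ≤ max a (n • ε) + ε := by gcongr; exact le_max_right _ _

variable [CompleteSpace E] {T : E →ₗ.[ℂ] E} {hT : IsSelfAdjoint T}

theorem ofReal_integral_spectralMeasure (f : C_c(ℝ, ℝ)) (v : E) :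
    ((∫ x, f x ∂(spectralMeasure T hT v) : ℝ) : ℂ) = ⟪v, ccCalculus T hT (toComplex f) v⟫_ℂ := by
  have hself : star (toComplex f) = toComplex f := by
    ext x
    simp
  rw [integral_spectralMeasure, ← Complex.conj_eq_iff_re, inner_conj_symm,
    ← ContinuousLinearMap.adjoint_inner_right, ← ContinuousLinearMap.star_eq_adjoint,
    star_ccCalculus, hself]

theorem ccCalculus_eq_re_add_I_smul_im (f : C_c(ℝ, ℂ)) : ccCalculus T hT f =
    ccCalculus T hT (toComplex (f.compLeft ⟨Complex.re, Complex.continuous_re⟩)) +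
      Complex.I • ccCalculus T hT (toComplex (f.compLeft ⟨Complex.im, Complex.continuous_im⟩)) := by
  rw [ccCalculus, ccCalculus, ccCalculus,
    ← cfc_smul Complex.I _ _ (continuousOn_spectrum T hT _),
    ← cfc_add _ (circleFun _) (fun x => Complex.I • circleFun _ x)
      (continuousOn_spectrum T hT _) ((continuousOn_spectrum T hT _).const_smul Complex.I)]
  refine cfc_congr fun z _ => ?_
  by_cases h1 : z = 1
  · simp [circleFun, h1]
  · simp [circleFun, h1, CompactlySupportedContinuousMap.compLeft_apply, mul_comm Complex.I,
      Complex.re_add_im]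

theorem inner_ccCalculus (f : C_c(ℝ, ℂ)) (v : E) :
    ⟪v, ccCalculus T hT f v⟫_ℂ = ∫ x, f x ∂(spectralMeasure T hT v) := by
  rw [ccCalculus_eq_re_add_I_smul_im, add_apply, smul_apply, inner_add_right, inner_smul_right,
    ← ofReal_integral_spectralMeasure, ← ofReal_integral_spectralMeasure, mul_comm]
  simpa [CompactlySupportedContinuousMap.compLeft_apply] using! integral_re_add_im f.integrable

theorem norm_indicator_one_le (s : Set ℝ) (x : ℝ) : ‖s.indicator (fun _ => (1 : ℂ)) x‖ ≤ 1 := by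
  simpa using norm_indicator_le_norm_self (s := s) (fun _ : ℝ => (1 : ℂ)) x

theorem inner_spectralProjection {Δ : Set ℝ} (hΔ : MeasurableSet Δ) (v : E) :
    ⟪v, spectralProjection T hT Δ v⟫_ℂ = (((spectralMeasure T hT v).real Δ : ℝ) : ℂ) := by
  rw [spectralProjection, inner_borelCalculus T hT (measurable_const.indicator hΔ)
    (norm_indicator_one_le Δ), integral_indicator_const _ hΔ]
  simp

-- `K` reduces `T` exactly when the reflection in `K` commutes with `T`, and then the reflection,
-- being unitary, commutes with every `g(T)`.
theorem Reduces.borelCalculus_mem {K : Submodule ℂ E}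
    (h : Reduces (cayley T hT : E →L[ℂ] E) K) {g : ℝ → ℂ} (hg : Measurable g) {C : ℝ}
    (hC : ∀ x, ‖g x‖ ≤ C) {v : E} (hv : v ∈ K) : borelCalculus T hT g v ∈ K := by
  have : CompleteSpace K := h.isClosed.completeSpace_coe
  have hsemiconj : Function.Semiconj K.reflection (cayley T hT : E →L[ℂ] E)
      (cayley T hT : E →L[ℂ] E) := fun x => by
    simp only [K.reflection_apply, map_sub, map_nsmul, h.semiconj_starProjection.eq]
  have hcompression :=
    borelCalculus_compression (J := K.reflection.toLinearIsometry) hsemiconj hg hC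
  rw [← K.reflection_eq_self_iff, ← LinearIsometryEquiv.eq_symm_apply]
  calc borelCalculus T hT g v
      = adjoint (K.reflection.toContinuousLinearEquiv : E →L[ℂ] E)
          (borelCalculus T hT g (K.reflection v)) := (DFunLike.congr_fun hcompression v).symm
    _ = K.reflection.symm (borelCalculus T hT g v) := by
      rw [(K.reflection_eq_self_iff v).mpr hv, LinearIsometryEquiv.adjoint_eq_symm]
      rfl

theorem spectralMeasure_eq_of_inner_spectralProjection_eq_zero {w v : E} {Δ : Set ℝ}
    (hΔ : MeasurableSet Δ) (h : ⟪w, spectralProjection T hT Δ v⟫_ℂ = 0) :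
    spectralMeasure T hT (w + v) Δ = spectralMeasure T hT (w - v) Δ ∧
      spectralMeasure T hT (w + Complex.I • v) Δ = spectralMeasure T hT (w - Complex.I • v) Δ := by
  have hpol := four_mul_inner_apply (spectralProjection T hT Δ) w v
  simp only [h, inner_spectralProjection hΔ] at hpol
  have hre := congrArg Complex.re hpol
  have him := congrArg Complex.im hpol
  simp only [Complex.sub_re, Complex.sub_im, Complex.mul_re, Complex.mul_im, Complex.I_re,
    Complex.I_im, Complex.ofReal_re, Complex.ofReal_im, mul_zero, zero_mul, one_mul, sub_self,
    sub_zero, zero_sub, zero_add, neg_sub, Complex.zero_re, Complex.zero_im] at hre him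
  refine ⟨(measureReal_eq_measureReal_iff).mp ?_, (measureReal_eq_measureReal_iff).mp ?_⟩ <;>
    linarith

theorem inner_ccCalculus_eq_zero_of_short_Ioc {w v : E} {ε : ℝ} (hε : 0 < ε)
    (h : ∀ a b, b ≤ a + ε → ⟪w, spectralProjection T hT (Set.Ioc a b) v⟫_ℂ = 0)
    (f : C_c(ℝ, ℂ)) : ⟪w, ccCalculus T hT f v⟫_ℂ = 0 := by
  have hIoc (a b : ℝ) (hab : b ≤ a + ε) :=
    spectralMeasure_eq_of_inner_spectralProjection_eq_zero measurableSet_Ioc (h a b hab)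
  have hμ : spectralMeasure T hT (w + v) = spectralMeasure T hT (w - v) :=
    measure_eq_of_short_Ioc hε fun a b hab => (hIoc a b hab).1
  have hμI : spectralMeasure T hT (w + Complex.I • v) = spectralMeasure T hT (w - Complex.I • v) :=
    measure_eq_of_short_Ioc hε fun a b hab => (hIoc a b hab).2
  have hpol := four_mul_inner_apply (ccCalculus T hT f) w v
  simp only [inner_ccCalculus, hμ, hμI] at hpol
  simpa using hpol

theorem spectralProjection_mem_spectralSpan {D : Set (Set ℝ)} {Δ : Set ℝ} (hΔ : Δ ∈ D)
    {S : Set E} {v : E} (hv : v ∈ S) :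
    spectralProjection T hT Δ v ∈ spectralSpan T hT D S :=
  Submodule.le_topologicalClosure _ (Submodule.subset_span ⟨Δ, hΔ, v, hv, rfl⟩)

instance (D : Set (Set ℝ)) (S : Set E) : CompleteSpace (spectralSpan T hT D S) :=
  Submodule.topologicalClosure.completeSpace _

theorem orbit_eq_spectralSpan {D : Set (Set ℝ)} (hD : ∀ Δ ∈ D, MeasurableSet Δ) {ε : ℝ}
    (hε : 0 < ε) (hDε : ∀ a b, b ≤ a + ε → Set.Ioc a b ∈ D) (S : Set E) :
    orbit T hT S = spectralSpan T hT D S := by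
  refine le_antisymm ?_ ?_ <;> refine Submodule.topologicalClosure_minimal _
    (Submodule.span_le.mpr ?_) (Submodule.isClosed_topologicalClosure _)
  · rintro _ ⟨f, v, hv, rfl⟩
    change _ ∈ spectralSpan T hT D S
    rw [← Submodule.orthogonal_orthogonal (spectralSpan T hT D S), Submodule.mem_orthogonal]
    intro w hw
    exact inner_ccCalculus_eq_zero_of_short_Ioc hε (fun a b hab =>
      Submodule.inner_left_of_mem_orthogonal
        (spectralProjection_mem_spectralSpan (hDε a b hab) hv) hw) f
  · rintro _ ⟨Δ, hΔ, v, hv, rfl⟩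
    exact (reduces_orbit S).borelCalculus_mem (measurable_const.indicator (hD Δ hΔ))
      (norm_indicator_one_le Δ) (subset_orbit S hv)

theorem orbit_eq_spectralSpan_intervals (S : Set E) :
    orbit T hT S = spectralSpan T hT intervals S :=
  orbit_eq_spectralSpan (fun _ h => Set.OrdConnected.measurableSet h) one_pos
    (fun _ _ _ => Set.ordConnected_Ioc) S

theorem orbit_eq_spectralSpan_intervalsOfLength {ε : ℝ} (hε : 0 < ε) (S : Set E) :
    orbit T hT S = spectralSpan T hT (intervalsOfLength ε) S :=
  orbit_eq_spectralSpan (D := intervalsOfLength ε) (fun _ h => h.1.measurableSet) hε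
    (fun a _ hab => ⟨Set.ordConnected_Ioc, a, fun _ hx => ⟨hx.1.le, hx.2.trans hab⟩⟩) S

end SpectralSpan

section PointSpectrum

variable {E : Type*} [NormedAddCommGroup E] [InnerProductSpace ℂ E] [CompleteSpace E]
  {T : E →ₗ.[ℂ] E} {hT : IsSelfAdjoint T}

theorem conj_eq_of_mem_eigenspace (hT : IsSelfAdjoint T) {z : ℂ} {φ : E}
    (h : φ ∈ eigenspace T z) (h0 : φ ≠ 0) : (starRingEnd ℂ) z = z := by
  have hsymm : ⟪z • φ, φ⟫_ℂ = ⟪φ, z • φ⟫_ℂ := (mem_graph_iff_of_isSelfAdjoint hT _ _).mp h _ _ h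
  rw [inner_smul_left, inner_smul_right] at hsymm
  exact mul_right_cancel₀ (inner_self_ne_zero.mpr h0) hsymm

theorem eigenspace_isOrtho (hT : IsSelfAdjoint T) {z z' : ℂ} (hz : z ≠ z') :
    eigenspace T z ⟂ eigenspace T z' := by
  rw [Submodule.isOrtho_iff_inner_eq]
  intro u hu v hv
  by_cases h0 : u = 0
  · rw [h0, inner_zero_left]
  have hsymm : ⟪z • u, v⟫_ℂ = ⟪u, z' • v⟫_ℂ := (mem_graph_iff_of_isSelfAdjoint hT _ _).mp hv _ _ hu
  rw [inner_smul_left, inner_smul_right, conj_eq_of_mem_eigenspace hT hu h0, ← sub_eq_zero,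
    ← sub_mul] at hsymm
  exact (mul_eq_zero.mp hsymm).resolve_left (sub_ne_zero.mpr hz)

theorem countable_of_orthonormal {F ι : Type*} [NormedAddCommGroup F] [InnerProductSpace ℂ F]
    [TopologicalSpace.SeparableSpace F] {v : ι → F} (hv : Orthonormal ℂ v) : Countable ι := by
  have hdisjoint : Pairwise (Function.onFun Disjoint fun i => Metric.ball (v i) (1 / 2)) := by
    intro i j hij
    refine Metric.ball_disjoint_ball ?_
    have hdist : dist (v i) (v j) ^ 2 = 2 := by
      rw [dist_eq_norm, norm_sub_sq (𝕜 := ℂ), hv.2 hij, hv.1, hv.1]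
      norm_num
    nlinarith [dist_nonneg (x := v i) (y := v j)]
  exact hdisjoint.countable_of_isOpen_disjoint (fun _ => Metric.isOpen_ball)
    fun i => Metric.nonempty_ball.mpr (by norm_num)

theorem countable_eigenvalues [TopologicalSpace.SeparableSpace E] (hT : IsSelfAdjoint T) :
    (eigenvalues T).Countable := by
  have hunit (z : eigenvalues T) : ∃ v ∈ eigenspace T z, ‖v‖ = 1 := by
    obtain ⟨v, hv, h0⟩ := Submodule.exists_mem_ne_zero_of_ne_bot z.2
    exact ⟨(‖v‖⁻¹ : ℂ) • v, Submodule.smul_mem _ _ hv, norm_smul_inv_norm h0⟩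
  choose v hv hnorm using hunit
  have hortho : Orthonormal ℂ v := ⟨hnorm, fun z z' hz => (Submodule.isOrtho_iff_inner_eq.mp
    (eigenspace_isOrtho hT (Subtype.coe_injective.ne hz))) _ (hv z) _ (hv z')⟩
  exact Set.countable_coe_iff.mp (countable_of_orthonormal hortho)

theorem add_smul_cayley_apply_of_mem_eigenspace {z : ℂ} {φ : E} (h : φ ∈ eigenspace T z) :
    (z + Complex.I) • (cayley T hT : E →L[ℂ] E) φ = (z - Complex.I) • φ := by
  rw [← map_smul, add_smul, sub_smul]
  exact cayley_spec T hT h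

theorem sub_smul_adjoint_cayley_apply_of_mem_eigenspace {z : ℂ} {φ : E}
    (h : φ ∈ eigenspace T z) :
    (z - Complex.I) • adjoint (cayley T hT : E →L[ℂ] E) φ = (z + Complex.I) • φ := by
  rw [← map_smul, ← add_smul_cayley_apply_of_mem_eigenspace (hT := hT) h, map_smul,
    unitary_adjoint_apply_apply]

theorem mem_invtSubmodule_of_le_eigenspace {z : ℂ} {V : Submodule ℂ E}
    (hV : V ≤ eigenspace T z) :
    V ∈ invtSubmodule ((cayley T hT : E →L[ℂ] E) : E →ₗ[ℂ] E) ∧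
      V ∈ invtSubmodule (adjoint (cayley T hT : E →L[ℂ] E) : E →ₗ[ℂ] E) := by
  have hz {φ : E} (hφ : φ ∈ V) (h0 : φ ≠ 0) : z.im = 0 :=
    Complex.conj_eq_iff_im.mp (conj_eq_of_mem_eigenspace hT (hV hφ) h0)
  constructor <;> intro φ hφ <;> obtain rfl | h0 := eq_or_ne φ 0
  · exact zero_mem _
  · have hp : z + Complex.I ≠ 0 := fun h => by simpa [hz hφ h0] using congrArg Complex.im h
    refine (V.smul_mem_iff hp).mp ?_
    exact add_smul_cayley_apply_of_mem_eigenspace (hT := hT) (hV hφ) ▸ V.smul_mem _ hφ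
  · exact zero_mem _
  · have hm : z - Complex.I ≠ 0 := fun h => by simpa [hz hφ h0] using congrArg Complex.im h
    refine (V.smul_mem_iff hm).mp ?_
    exact sub_smul_adjoint_cayley_apply_of_mem_eigenspace (hT := hT) (hV hφ) ▸ V.smul_mem _ hφ

theorem reduces_closure_iSup_of_le_eigenspace {ι : Sort*} {z : ι → ℂ} {V : ι → Submodule ℂ E}
    (h : ∀ i, V i ≤ eigenspace T (z i)) :
    Reduces (cayley T hT : E →L[ℂ] E) (⨆ i, V i).topologicalClosure :=
  reduces_topologicalClosure
    (iSup_le fun i => (mem_invtSubmodule_of_le_eigenspace (h i)).1.trans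
      (Submodule.comap_mono (le_iSup V i)))
    (iSup_le fun i => (mem_invtSubmodule_of_le_eigenspace (h i)).2.trans
      (Submodule.comap_mono (le_iSup V i)))

theorem eigenProjection_mem_eigenspace (z : ℂ) (x : E) :
    eigenProjection T hT z x ∈ eigenspace T z := by
  have : CompleteSpace (eigenspace T z) := (isClosed_eigenspace hT z).completeSpace_coe
  exact (eigenspace T z).starProjection_apply_mem x

theorem projectedEigenspace_le_eigenspace (S : Submodule ℂ E) (z : ℂ) :
    projectedEigenspace T hT S z ≤ eigenspace T z := by
  rintro _ ⟨x, -, rfl⟩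
  exact eigenProjection_mem_eigenspace z x

theorem HasPurePointSpectrum.eq_zero (hpp : HasPurePointSpectrum T) {u : E}
    (h : ∀ z, eigenProjection T hT z u = 0) : u = 0 := by
  have hu : u ∈ ((⨆ z, eigenspace T z).topologicalClosure)ᗮ := by
    rw [Submodule.orthogonal_closure, ← Submodule.iInf_orthogonal, Submodule.mem_iInf]
    intro z
    have : CompleteSpace (eigenspace T z) := (isClosed_eigenspace hT z).completeSpace_coe
    exact (eigenspace T z).starProjection_apply_eq_zero_iff.mp (h z)
  rwa [hpp, Submodule.top_orthogonal_eq_bot, Submodule.mem_bot] at hu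

theorem Reduces.semiconj_eigenProjection {K : Submodule ℂ E} [CompleteSpace K]
    (h : Reduces (cayley T hT : E →L[ℂ] E) K) (z : ℂ) :
    Function.Semiconj (eigenProjection T hT z) K.starProjection K.starProjection := by
  have : CompleteSpace (eigenspace T z) := (isClosed_eigenspace hT z).completeSpace_coe
  have hinv : eigenspace T z ∈ invtSubmodule (K.starProjection : E →ₗ[ℂ] E) := fun φ hφ => by
    have hgraph := h.starProjection_mem_graph hφ
    rwa [LinearMap.smul_apply, map_smul] at hgraph
  refine Reduces.semiconj_starProjection ⟨isClosed_eigenspace hT z, hinv, ?_⟩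
  rwa [← ContinuousLinearMap.star_eq_adjoint, (isSelfAdjoint_starProjection K).star_eq]

theorem Reduces.eigenProjection_mem {K : Submodule ℂ E}
    (h : Reduces (cayley T hT : E →L[ℂ] E) K) (z : ℂ) {x : E} (hx : x ∈ K) :
    eigenProjection T hT z x ∈ K := by
  have : CompleteSpace K := h.isClosed.completeSpace_coe
  rw [← K.starProjection_eq_self_iff, ← (h.semiconj_eigenProjection z).eq,
    K.starProjection_eq_self_iff.mpr hx]

theorem eigenProjection_mem_iSup_projectedEigenspace {S : Submodule ℂ E} {v : E} (hv : v ∈ S)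
    (z : ℂ) : eigenProjection T hT z v ∈ ⨆ z : eigenvalues T, projectedEigenspace T hT S z := by
  by_cases hz : z ∈ eigenvalues T
  · exact Submodule.mem_iSup_of_mem (⟨z, hz⟩ : eigenvalues T) ⟨v, hv, rfl⟩
  · have hbot : eigenProjection T hT z v ∈ (⊥ : Submodule ℂ E) :=
      not_not.mp hz ▸ eigenProjection_mem_eigenspace z v
    rw [(Submodule.mem_bot ℂ).mp hbot]
    exact zero_mem _

theorem orbit_eq_closure_iSup_projectedEigenspace (hpp : HasPurePointSpectrum T)
    (S : Submodule ℂ E) : orbit T hT S =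
      (⨆ z : eigenvalues T, projectedEigenspace T hT S z).topologicalClosure := by
  refine le_antisymm ?_ ?_
  · have hreduces : Reduces (cayley T hT : E →L[ℂ] E)
        (⨆ z : eigenvalues T, projectedEigenspace T hT S z).topologicalClosure :=
      reduces_closure_iSup_of_le_eigenspace fun z => projectedEigenspace_le_eigenspace S z
    refine hreduces.orbit_le fun v hv => ?_
    set W := (⨆ z : eigenvalues T, projectedEigenspace T hT S z).topologicalClosure
    have : CompleteSpace W := hreduces.isClosed.completeSpace_coe
    rw [SetLike.mem_coe, ← W.starProjection_eq_self_iff, eq_comm, ← sub_eq_zero]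
    refine hpp.eq_zero (hT := hT) fun z => ?_
    rw [map_sub, (hreduces.semiconj_eigenProjection z).eq, sub_eq_zero, eq_comm,
      W.starProjection_eq_self_iff]
    exact Submodule.le_topologicalClosure _ (eigenProjection_mem_iSup_projectedEigenspace hv z)
  · refine Submodule.topologicalClosure_minimal _ (iSup_le fun z => ?_)
      (Submodule.isClosed_topologicalClosure _)
    rintro _ ⟨x, hx, rfl⟩
    exact (reduces_orbit _).eigenProjection_mem z (subset_orbit _ hx)

theorem isClosedOrthogonalSum_orbit (hpp : HasPurePointSpectrum T) (S : Submodule ℂ E) :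
    IsClosedOrthogonalSum (orbit T hT S)
      (fun z : eigenvalues T => projectedEigenspace T hT S z) :=
  ⟨fun _ _ hij => (eigenspace_isOrtho hT (Subtype.coe_injective.ne hij)).mono
    (projectedEigenspace_le_eigenspace S _) (projectedEigenspace_le_eigenspace S _),
    orbit_eq_closure_iSup_projectedEigenspace hpp S⟩

theorem orbit_eq_top_iff (hpp : HasPurePointSpectrum T) (S : Submodule ℂ E) :
    orbit T hT S = ⊤ ↔ ∀ φ, IsEigenmode T φ → φ ∉ Sᗮ := by
  refine ⟨?_, fun h => ?_⟩
  · rintro htop φ ⟨h0, z, hz⟩ hφ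
    have hline : Submodule.span ℂ {φ} ≤ eigenspace T z :=
      (Submodule.span_singleton_le_iff_mem _ _).mpr hz
    have hreduces : Reduces (cayley T hT : E →L[ℂ] E) (Submodule.span ℂ {φ}).topologicalClosure :=
      reduces_topologicalClosure (mem_invtSubmodule_of_le_eigenspace hline).1
        (mem_invtSubmodule_of_le_eigenspace hline).2
    have hortho := hreduces.le_orthogonal_orbit (S := S) <| by
      rw [Submodule.orthogonal_closure]
      exact fun x hx => Submodule.mem_orthogonal_singleton_iff_inner_right.mpr
        (Submodule.inner_left_of_mem_orthogonal hx hφ)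
    rw [htop, Submodule.top_orthogonal_eq_bot] at hortho
    exact h0 (hortho (Submodule.le_topologicalClosure _ (Submodule.mem_span_singleton_self φ)))
  · rw [← Submodule.orthogonal_eq_bot_iff, Submodule.eq_bot_iff]
    refine fun u hu => hpp.eq_zero (hT := hT) fun z => ?_
    by_contra hne
    exact h _ ⟨hne, z, eigenProjection_mem_eigenspace z u⟩
      (Submodule.orthogonal_le (subset_orbit _)
        ((reduces_orbit _).orthogonal.eigenProjection_mem z hu))

end PointSpectrum

section Isometry

variable {𝕜 D E F : Type*} [RCLike 𝕜] [NormedAddCommGroup D] [InnerProductSpace 𝕜 D]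
  [NormedAddCommGroup E] [InnerProductSpace 𝕜 E] [NormedAddCommGroup F] [InnerProductSpace 𝕜 F]

/-- The part of the operator `T` in the range of the isometry `J`, as an operator in the domain
of `J`. -/
noncomputable def compress (T : E →ₗ.[𝕜] E) (J : F →ₗᵢ[𝕜] E) : F →ₗ.[𝕜] F :=
  (T.graph.comap (J.toLinearMap.prodMap J.toLinearMap)).toLinearPMap

theorem mem_graph_compress {T : E →ₗ.[𝕜] E} {J : F →ₗᵢ[𝕜] E} {x y : F} :
    (x, y) ∈ (compress T J).graph ↔ (J x, J y) ∈ T.graph := by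
  rw [compress, Submodule.toLinearPMap_graph_eq]
  · rfl
  · rintro ⟨x, y⟩ (hxy : (J x, J y) ∈ T.graph) (rfl : x = 0)
    exact (map_eq_zero_iff J J.injective).mp (T.graph_fst_eq_zero_snd hxy J.map_zero)

variable [CompleteSpace E]

theorem isSelfAdjoint_of_graph {T : E →ₗ.[𝕜] E} (hdense : Dense (T.domain : Set E))
    (h : ∀ x y, (x, y) ∈ T.graph ↔ ∀ a b, (a, b) ∈ T.graph → ⟪b, x⟫_𝕜 = ⟪a, y⟫_𝕜) :
    IsSelfAdjoint T := by
  rw [LinearPMap.isSelfAdjoint_def]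
  refine LinearPMap.eq_of_eq_graph ?_
  rw [LinearPMap.adjoint_graph_eq_graph_adjoint hdense]
  ext ⟨x, y⟩
  rw [Submodule.mem_adjoint_iff, h]
  simp only [sub_eq_zero]

variable [CompleteSpace F] {J : F →ₗᵢ[𝕜] E}

theorem adjoint_isometry_apply (J : F →ₗᵢ[𝕜] E) (x : F) :
    adjoint J.toContinuousLinearMap (J x) = x :=
  ext_inner_left 𝕜 fun y => by
    rw [ContinuousLinearMap.adjoint_inner_right]
    exact J.inner_map_map y x

theorem isometry_adjoint_apply_of_mem_range {x : E} (hx : x ∈ J.range) :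
    J (adjoint J.toContinuousLinearMap x) = x := by
  obtain ⟨y, rfl⟩ := hx
  exact congrArg J (adjoint_isometry_apply J y)

theorem isometry_adjoint_apply [CompleteSpace J.range] (x : E) :
    J (adjoint J.toContinuousLinearMap x) = J.range.starProjection x := by
  rw [← isometry_adjoint_apply_of_mem_range (J.range.starProjection_apply_mem x)]
  congr 1
  refine ext_inner_left 𝕜 fun y => ?_
  have hy : J.toContinuousLinearMap y ∈ J.range := LinearMap.mem_range_self J.toLinearMap y
  rw [ContinuousLinearMap.adjoint_inner_right, ContinuousLinearMap.adjoint_inner_right,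
    ← Submodule.inner_starProjection_left_eq_right,
    J.range.starProjection_eq_self_iff.mpr hy]

variable [CompleteSpace D] in
theorem comp_isometry_comp_adjoint {G : E →L[𝕜] D} (hG : ∀ d, adjoint G d ∈ J.range) :
    G ∘L J.toContinuousLinearMap ∘L adjoint J.toContinuousLinearMap = G := by
  refine adjoint.injective (ContinuousLinearMap.ext fun d => ?_)
  simp only [ContinuousLinearMap.adjoint_comp, ContinuousLinearMap.adjoint_adjoint]
  exact isometry_adjoint_apply_of_mem_range (hG d)

end Isometry

section Compression

variable {E F : Type*} [NormedAddCommGroup E] [InnerProductSpace ℂ E]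
  [NormedAddCommGroup F] [InnerProductSpace ℂ F] [CompleteSpace E] [CompleteSpace F]
  {T : E →ₗ.[ℂ] E} {hT : IsSelfAdjoint T} {J : F →ₗᵢ[ℂ] E}

theorem isSelfAdjoint_compress (h : Reduces (cayley T hT : E →L[ℂ] E) J.range) :
    IsSelfAdjoint (compress T J) := by
  have : CompleteSpace J.range := h.isClosed.completeSpace_coe
  have hadj {x y : E} (hxy : (x, y) ∈ T.graph) :
      (adjoint J.toContinuousLinearMap x, adjoint J.toContinuousLinearMap y) ∈
        (compress T J).graph := by
    rw [mem_graph_compress, isometry_adjoint_apply, isometry_adjoint_apply]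
    exact h.starProjection_mem_graph hxy
  refine isSelfAdjoint_of_graph ?_ fun x y => ?_
  · have hsurj : Function.Surjective (adjoint J.toContinuousLinearMap) :=
      fun x => ⟨J x, adjoint_isometry_apply J x⟩
    have hdense := hsurj.denseRange.dense_image (ContinuousLinearMap.continuous _) hT.dense_domain
    refine hdense.mono ?_
    rintro _ ⟨x, hx, rfl⟩
    obtain ⟨y, hy⟩ := LinearPMap.mem_domain_iff.mp hx
    exact LinearPMap.mem_domain_iff.mpr ⟨_, hadj hy⟩
  · rw [mem_graph_compress, mem_graph_iff_of_isSelfAdjoint hT]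
    refine ⟨fun hxy a b hab => ?_, fun hxy a b hab => ?_⟩
    · simpa only [J.inner_map_map] using hxy _ _ (mem_graph_compress.mp hab)
    · simpa only [ContinuousLinearMap.adjoint_inner_left] using! hxy _ _ (hadj hab)

theorem Reduces.map_isometry {V : unitary (E →L[ℂ] E)} {W : unitary (F →L[ℂ] F)}
    (h : Function.Semiconj J (W : F →L[ℂ] F) (V : E →L[ℂ] E)) {K : Submodule ℂ F}
    (hK : Reduces (W : F →L[ℂ] F) K) : Reduces (V : E →L[ℂ] E) (K.map J.toLinearMap) where
  isClosed := J.isometry.isClosedEmbedding.isClosedMap _ hK.isClosed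
  mem_invtSubmodule := by
    rintro _ ⟨x, hx, rfl⟩
    exact ⟨_, hK.mem_invtSubmodule hx, h x⟩
  mem_invtSubmodule_adjoint := by
    rintro _ ⟨x, hx, rfl⟩
    exact ⟨_, hK.mem_invtSubmodule_adjoint hx, semiconj_adjoint_of_unitary h x⟩

section MinimalTriple

variable {D : Type*} [NormedAddCommGroup D] [InnerProductSpace ℂ D] [CompleteSpace D]
  {G : E →L[ℂ] D}

theorem semiconj_cayley_compress (hS : IsSelfAdjoint (compress T J)) :
    Function.Semiconj J (cayley (compress T J) hS : F →L[ℂ] F) (cayley T hT : E →L[ℂ] E) :=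
  semiconj_cayley (J := J.toContinuousLinearMap) hT hS fun _ _ => mem_graph_compress.mp

theorem frictionFunction_compress (hS : IsSelfAdjoint (compress T J))
    (hG : ∀ d, adjoint G d ∈ J.range) (t : ℝ) :
    frictionFunction (compress T J) hS (G ∘L J.toContinuousLinearMap) t =
      frictionFunction T hT G t := by
  have hG' := comp_isometry_comp_adjoint hG
  rw [frictionFunction, frictionFunction,
    ← evolution_compression (semiconj_cayley_compress (hT := hT) hS)]
  conv_rhs => rw [← hG']
  simp only [ContinuousLinearMap.adjoint_comp, ContinuousLinearMap.adjoint_adjoint,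
    ContinuousLinearMap.comp_assoc]

theorem isMinimalTriple_compress (hS : IsSelfAdjoint (compress T J))
    (hJ : J.range = orbit T hT (Set.range (adjoint G))) :
    IsMinimalTriple (frictionFunction T hT G) (compress T J) hS
      (G ∘L J.toContinuousLinearMap) := by
  have hG : ∀ d, adjoint G d ∈ J.range := fun d => hJ ▸ subset_orbit _ ⟨d, rfl⟩
  refine ⟨fun t _ => (frictionFunction_compress hS hG t).symm, ?_⟩
  set W := orbit (compress T J) hS (Set.range (adjoint (G ∘L J.toContinuousLinearMap)))
  have hW : Reduces (cayley T hT : E →L[ℂ] E) (W.map J.toLinearMap) :=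
    (reduces_orbit _).map_isometry (semiconj_cayley_compress hS)
  have hle : J.range ≤ W.map J.toLinearMap := by
    rw [hJ]
    refine hW.orbit_le ?_
    rintro _ ⟨d, rfl⟩
    refine ⟨_, subset_orbit _ ⟨d, rfl⟩, ?_⟩
    rw [ContinuousLinearMap.adjoint_comp]
    exact isometry_adjoint_apply_of_mem_range (hG d)
  rw [eq_top_iff]
  intro x _
  obtain ⟨w, hw, hwx⟩ := hle ⟨x, rfl⟩
  exact J.injective hwx ▸ hw

end MinimalTriple

end Compression

section OrthogonalSum

variable {𝕜 H : Type*} [RCLike 𝕜] [NormedAddCommGroup H] [InnerProductSpace 𝕜 H]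
  {A B : Submodule 𝕜 H}

theorem add_eq_add_iff_of_isOrtho (hAB : B ≤ Aᗮ) {a a' : A} {b b' : B} :
    (a : H) + b = a' + b' ↔ a = a' ∧ b = b' := by
  refine ⟨fun h => ?_, fun h => by rw [h.1, h.2]⟩
  have hsub : ((a - a' : A) : H) = ((b' - b : B) : H) := by
    push_cast
    linear_combination (norm := module) h
  have ha : ((a - a' : A) : H) = 0 :=
    Submodule.disjoint_def.mp A.orthogonal_disjoint _ (a - a').2 (hsub ▸ hAB (b' - b).2)
  have hb : ((b' - b : B) : H) = 0 := hsub ▸ ha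
  exact ⟨sub_eq_zero.mp (Subtype.ext ha), (sub_eq_zero.mp (Subtype.ext hb)).symm⟩

theorem isClosed_sup_of_isOrtho [A.HasOrthogonalProjection] [B.HasOrthogonalProjection]
    (hAB : B ≤ Aᗮ) : IsClosed ((A ⊔ B : Submodule 𝕜 H) : Set H) := by
  have hsup : ((A ⊔ B : Submodule 𝕜 H) : Set H) =
      {x | A.starProjection x + B.starProjection x = x} := by
    refine Set.Subset.antisymm (fun x hx => ?_) fun x hx => hx ▸ Submodule.add_mem_sup
      (A.starProjection_apply_mem x) (B.starProjection_apply_mem x)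
    obtain ⟨a, ha, b, hb, rfl⟩ := Submodule.mem_sup.mp hx
    rw [Set.mem_ofPred_eq, map_add, map_add, A.starProjection_eq_self_iff.mpr ha,
      B.starProjection_eq_self_iff.mpr hb, A.starProjection_apply_eq_zero_iff.mpr (hAB hb),
      B.starProjection_apply_eq_zero_iff.mpr (Submodule.IsOrtho.symm hAB ha), add_zero, zero_add]
  rw [hsup]
  exact isClosed_eq (by fun_prop) continuous_id

theorem comap_subtype_sup_map_subtype (hAB : B ≤ Aᗮ) (L : Submodule 𝕜 B) :
    (A ⊔ L.map B.subtype).comap B.subtype = L := by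
  refine le_antisymm (fun b hb => ?_) (Submodule.map_le_iff_le_comap.mp le_sup_right)
  obtain ⟨a, ha, _, ⟨c, hc, rfl⟩, hac⟩ := Submodule.mem_sup.mp hb
  have hac' : ((⟨a, ha⟩ : A) : H) + c = ((0 : A) : H) + b := by simpa using! hac
  exact ((add_eq_add_iff_of_isOrtho hAB).mp hac').2 ▸ hc

theorem starProjection_coe_of_le_sup (hAB : B ≤ Aᗮ) {K : Submodule 𝕜 H}
    [K.HasOrthogonalProjection] {L : Submodule 𝕜 B} [L.HasOrthogonalProjection]
    (hK : K ≤ A ⊔ B) (hA : A ≤ K) (hL : K.comap B.subtype = L) (b : B) :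
    K.starProjection (b : H) = (L.starProjection b : H) := by
  refine Submodule.eq_starProjection_of_mem_orthogonal (hL.ge (L.starProjection_apply_mem b)) ?_
  rw [Submodule.mem_orthogonal]
  intro k hk
  obtain ⟨a, ha, c, hc, rfl⟩ := Submodule.mem_sup.mp (hK hk)
  have hcL : (⟨c, hc⟩ : B) ∈ L := hL.le ((Submodule.add_mem_iff_right _ (hA ha)).mp hk)
  have hcb : ⟪(⟨c, hc⟩ : B), b - L.starProjection b⟫_𝕜 = 0 :=
    Submodule.inner_right_of_mem_orthogonal hcL (L.sub_starProjection_mem_orthogonal b)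
  rw [inner_add_left, ← Submodule.coe_sub,
    Submodule.inner_right_of_mem_orthogonal ha (hAB (b - L.starProjection b).2), zero_add]
  exact hcb

/-- The isometric inclusion into `B` of a subspace `L` of `B`, seen as a subspace of `H`. -/
def mapSubtypeIsometry (L : Submodule 𝕜 B) : L.map B.subtype →ₗᵢ[𝕜] B where
  toLinearMap := Submodule.inclusion (Submodule.map_subtype_le B L)
  norm_map' _ := rfl

theorem range_mapSubtypeIsometry (L : Submodule 𝕜 B) : (mapSubtypeIsometry L).range = L := by
  ext b
  constructor
  · rintro ⟨⟨_, c, hc, rfl⟩, rfl⟩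
    exact hc
  · exact fun hb => ⟨⟨b, b, hb, rfl⟩, rfl⟩

end OrthogonalSum

section BlockForm

variable {H : Type*} [NormedAddCommGroup H] [InnerProductSpace ℂ H]
  {A B K : Submodule ℂ H} [CompleteSpace A] [CompleteSpace B]
  {T : H →ₗ.[ℂ] H} {TA : A →ₗ.[ℂ] A} {TB : B →ₗ.[ℂ] B} {G : B →L[ℂ] A}

theorem hasBlockForm_iff_graph : HasBlockForm T K A B TA TB G ↔
    ∀ x y : H, (x ∈ K ∧ (x, y) ∈ T.graph) ↔ ∃ (a a' : A) (b b' : B), (a, a') ∈ TA.graph ∧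
      (b, b') ∈ TB.graph ∧ x = (a : H) + b ∧
      y = ((a' + G b : A) : H) + ((adjoint G a + b' : B) : H) := by
  refine forall₂_congr fun x y => iff_congr Iff.rfl ⟨?_, ?_⟩
  · rintro ⟨a, b, hx, hy⟩
    exact ⟨a, TA a, b, TB b, TA.mem_graph a, TB.mem_graph b, hx, hy⟩
  · rintro ⟨a, a', b, b', ha, hb, hx, hy⟩
    obtain ⟨a₀, rfl, rfl⟩ := TA.mem_graph_iff.mp ha
    obtain ⟨b₀, rfl, rfl⟩ := TB.mem_graph_iff.mp hb
    exact ⟨a₀, b₀, hx, hy⟩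

theorem HasBlockForm.swap (h : HasBlockForm T K A B TA TB G) :
    HasBlockForm T K B A TB TA (adjoint G) := by
  intro x y
  rw [h x y, exists_comm]
  refine exists₂_congr fun b a => ?_
  rw [ContinuousLinearMap.adjoint_adjoint, add_comm (a : H), add_comm (TA a),
    add_comm (adjoint G _), add_comm ((_ : A) : H)]

theorem HasBlockForm.mem_graph (h : HasBlockForm T K A B TA TB G) {a a' : A} {b b' : B}
    (ha : (a, a') ∈ TA.graph) (hb : (b, b') ∈ TB.graph) :
    ((a : H) + b, ((a' + G b : A) : H) + ((adjoint G a + b' : B) : H)) ∈ T.graph :=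
  ((hasBlockForm_iff_graph.mp h _ _).mpr ⟨a, a', b, b', ha, hb, rfl, rfl⟩).2

theorem HasBlockForm.exists_of_mem_graph (h : HasBlockForm T K A B TA TB G) {x y : H}
    (hx : x ∈ K) (hxy : (x, y) ∈ T.graph) : ∃ (a a' : A) (b b' : B), (a, a') ∈ TA.graph ∧
      (b, b') ∈ TB.graph ∧ x = (a : H) + b ∧
      y = ((a' + G b : A) : H) + ((adjoint G a + b' : B) : H) :=
  (hasBlockForm_iff_graph.mp h _ _).mp ⟨hx, hxy⟩

theorem HasBlockForm.mem_graph_left (h : HasBlockForm T K A B TA TB G) {a a' : A}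
    (ha : (a, a') ∈ TA.graph) : ((a : H), (a' : H) + (adjoint G a : H)) ∈ T.graph := by
  simpa using h.mem_graph ha (zero_mem TB.graph)

theorem HasBlockForm.mem_graph_right (h : HasBlockForm T K A B TA TB G) {b b' : B}
    (hb : (b, b') ∈ TB.graph) : ((b : H), (G b : H) + (b' : H)) ∈ T.graph := by
  simpa using h.mem_graph (zero_mem TA.graph) hb

theorem HasBlockForm.adjoint_apply_eq_zero_of_mem_graph (h : HasBlockForm T ⊤ A B TA TB G)
    (hAB : B ≤ Aᗮ) {a a' : A} (ha : ((a : H), (a' : H)) ∈ T.graph) : adjoint G a = 0 := by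
  obtain ⟨c, c', d, d', -, hd, hx, hy⟩ := h.exists_of_mem_graph Submodule.mem_top ha
  rw [← add_zero (a : H), ← Submodule.coe_zero (p := B), add_eq_add_iff_of_isOrtho hAB] at hx
  rw [← add_zero (a' : H), ← Submodule.coe_zero (p := B), add_eq_add_iff_of_isOrtho hAB] at hy
  rw [TB.graph_fst_eq_zero_snd hd hx.2.symm, add_zero, ← hx.1] at hy
  exact hy.2.symm

section Uniqueness

variable [CompleteSpace H] {hT : IsSelfAdjoint T} {hTB : IsSelfAdjoint TB} {M : Submodule ℂ H}

theorem HasBlockForm.adjoint_apply_mem (h : HasBlockForm T K A B TA TB G)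
    (hTA : IsSelfAdjoint TA) (hM : Reduces (cayley T hT : H →L[ℂ] H) M) (hA : A ≤ M) (a : A) :
    (adjoint G a : H) ∈ M := by
  have hclosed : IsClosed {a : A | (adjoint G a : H) ∈ M} :=
    hM.isClosed.preimage (continuous_subtype_val.comp (adjoint G).continuous)
  refine hclosed.closure_subset_iff.mpr (fun a ha => ?_) (hTA.dense_domain a)
  obtain ⟨a', ha'⟩ := LinearPMap.mem_domain_iff.mp ha
  exact (Submodule.add_mem_iff_right _ (hA a'.2)).mp
    (hM.mem_of_mem_graph (hA a.2) (h.mem_graph_left ha'))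

theorem HasBlockForm.reduces_comap_subtype (h : HasBlockForm T (A ⊔ B) A B TA TB G)
    (hAB : B ≤ Aᗮ) (hM : Reduces (cayley T hT : H →L[ℂ] H) M) (hMAB : M ≤ A ⊔ B) (hA : A ≤ M) :
    Reduces (cayley TB hTB : B →L[ℂ] B) (M.comap B.subtype) := by
  have : CompleteSpace M := hM.isClosed.completeSpace_coe
  set L := M.comap B.subtype with hL
  have : CompleteSpace L := (hM.isClosed.preimage continuous_subtype_val).completeSpace_coe
  have hproj := starProjection_coe_of_le_sup hAB hMAB hA hL.symm
  refine reduces_of_starProjection_mem_graph fun b b' hb => ?_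
  have hgraph := hM.starProjection_mem_graph (h.mem_graph_right hb)
  rw [map_add, hproj, hproj, M.starProjection_eq_self_iff.mpr (hA (G b).2)] at hgraph
  have hmem : ((L.starProjection b : B) : H) ∈ A ⊔ B := Submodule.mem_sup_right (Subtype.prop _)
  obtain ⟨a, a', c, c', ha, hc, hx, hy⟩ := h.exists_of_mem_graph hmem hgraph
  rw [← zero_add ((L.starProjection b : B) : H), ← Submodule.coe_zero (p := A),
    add_eq_add_iff_of_isOrtho hAB] at hx
  obtain ⟨rfl, hxc⟩ := hx
  rw [map_zero, zero_add, add_eq_add_iff_of_isOrtho hAB] at hy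
  rwa [hxc, hy.2]

theorem IsMinimalExtensionIn.eq_orbit {a : ℝ → A →L[ℂ] A} (hTA : IsSelfAdjoint TA)
    (h : IsMinimalExtensionIn T hT A TA a K) : K = orbit T hT A := by
  obtain ⟨hinv, B, _, TB, hTB, G, hAB, rfl, hblock, htriple⟩ := h
  have hle : orbit T hT A ≤ A ⊔ B := (isInvariant_iff_reduces.mp hinv).orbit_le
    (le_sup_left : A ≤ A ⊔ B)
  have hA : A ≤ orbit T hT A := subset_orbit _
  have hG : Set.range (adjoint G) ⊆ (orbit T hT A).comap B.subtype := by
    rintro _ ⟨a, rfl⟩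
    exact hblock.adjoint_apply_mem hTA (reduces_orbit _) hA a
  have hB := (hblock.reduces_comap_subtype (hTB := hTB) hAB (reduces_orbit _) hle hA).orbit_le hG
  rw [htriple.minimal] at hB
  exact le_antisymm (sup_le hA fun b hb => hB (Submodule.mem_top (x := (⟨b, hb⟩ : B)))) hle

end Uniqueness

section Existence

theorem HasBlockForm.restrict (h : HasBlockForm T ⊤ A B TA TB G) (hAB : B ≤ Aᗮ)
    {L : Submodule ℂ B} [CompleteSpace (L.map B.subtype)]
    {hTB : IsSelfAdjoint TB} (hL : Reduces (cayley TB hTB : B →L[ℂ] B) L)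
    (hG : ∀ a, adjoint G a ∈ L) :
    HasBlockForm T (A ⊔ L.map B.subtype) A (L.map B.subtype) TA
      (compress TB (mapSubtypeIsometry L)) (G ∘L (mapSubtypeIsometry L).toContinuousLinearMap) := by
  set J := mapSubtypeIsometry L
  have hadj (a : A) : adjoint (G ∘L J.toContinuousLinearMap) a = (adjoint G a : H) := by
    rw [← isometry_adjoint_apply_of_mem_range ((range_mapSubtypeIsometry L).ge (hG a)),
      ContinuousLinearMap.adjoint_comp]
    rfl
  rw [hasBlockForm_iff_graph]
  intro x y
  constructor
  · rintro ⟨hx, hxy⟩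
    obtain ⟨a, a', b, b', ha, hb, rfl, rfl⟩ := h.exists_of_mem_graph Submodule.mem_top hxy
    have hbL : b ∈ L := by
      rw [← comap_subtype_sup_map_subtype hAB L]
      exact (Submodule.add_mem_iff_right _ (Submodule.mem_sup_left a.2)).mp hx
    have hbL' : b' ∈ L := hL.mem_of_mem_graph hbL hb
    refine ⟨a, a', ⟨b, b, hbL, rfl⟩, ⟨b', b', hbL', rfl⟩, ha, mem_graph_compress.mpr hb, rfl, ?_⟩
    simp only [Submodule.coe_add, hadj]
    rfl
  · rintro ⟨a, a', c, c', ha, hc, rfl, rfl⟩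
    refine ⟨Submodule.add_mem_sup a.2 c.2, ?_⟩
    simp only [Submodule.coe_add, hadj]
    exact h.mem_graph ha (mem_graph_compress.mp hc)

variable [CompleteSpace H] {hT : IsSelfAdjoint T} {hTB : IsSelfAdjoint TB}

theorem HasBlockForm.reduces_sup (h : HasBlockForm T ⊤ A B TA TB G) (hAB : B ≤ Aᗮ)
    {L : Submodule ℂ B} (hL : Reduces (cayley TB hTB : B →L[ℂ] B) L)
    (hG : ∀ a, adjoint G a ∈ L) :
    Reduces (cayley T hT : H →L[ℂ] H) (A ⊔ L.map B.subtype) := by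
  have : CompleteSpace L := hL.isClosed.completeSpace_coe
  have : CompleteSpace (L.map B.subtype) := B.subtypeₗᵢ.completeSpace_map L
  have hLB : L.map B.subtype ≤ B := Submodule.map_subtype_le B L
  have : CompleteSpace (A ⊔ L.map B.subtype : Submodule ℂ H) :=
    (isClosed_sup_of_isOrtho (hLB.trans hAB)).completeSpace_coe
  have hproj (a : A) (b : B) :
      (A ⊔ L.map B.subtype).starProjection ((a : H) + b) = a + (L.starProjection b : B) := by
    rw [map_add, Submodule.starProjection_eq_self_iff.mpr (Submodule.mem_sup_left a.2),
      starProjection_coe_of_le_sup hAB (sup_le_sup_left hLB A) le_sup_left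
        (comap_subtype_sup_map_subtype hAB L)]
  have hGL (b : B) : G (L.starProjection b) = G b := ext_inner_left ℂ fun a => by
    rw [← ContinuousLinearMap.adjoint_inner_left G, ← ContinuousLinearMap.adjoint_inner_left G,
      ← Submodule.inner_starProjection_left_eq_right, L.starProjection_eq_self_iff.mpr (hG a)]
  refine reduces_of_starProjection_mem_graph fun x y hxy => ?_
  obtain ⟨a, a', b, b', ha, hb, rfl, rfl⟩ := h.exists_of_mem_graph Submodule.mem_top hxy
  rw [hproj, hproj, map_add, L.starProjection_eq_self_iff.mpr (hG a), ← hGL b]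
  exact h.mem_graph ha (hL.starProjection_mem_graph hb)

theorem HasBlockForm.isMinimalExtensionIn_sup (h : HasBlockForm T ⊤ A B TA TB G)
    (hAB : B ≤ Aᗮ) : IsMinimalExtensionIn T hT A TA (frictionFunction TB hTB G)
      (A ⊔ (orbit TB hTB (Set.range (adjoint G))).map B.subtype) := by
  set L := orbit TB hTB (Set.range (adjoint G))
  have hL : Reduces (cayley TB hTB : B →L[ℂ] B) L := reduces_orbit _
  have hG (a : A) : adjoint G a ∈ L := subset_orbit _ ⟨a, rfl⟩
  have hLc : CompleteSpace (L.map B.subtype) := B.subtypeₗᵢ.completeSpace_map L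
  have hrange := range_mapSubtypeIsometry L
  exact ⟨isInvariant_iff_reduces.mpr (h.reduces_sup hAB hL hG), L.map B.subtype, hLc, _,
    isSelfAdjoint_compress (hrange.symm ▸ hL), _, (Submodule.map_subtype_le B L).trans hAB, rfl,
    h.restrict hAB hL hG, isMinimalTriple_compress _ hrange⟩

theorem HasBlockForm.isMinimalExtensionIn_orbit (h : HasBlockForm T ⊤ A B TA TB G)
    (hTA : IsSelfAdjoint TA) (hAB : B ≤ Aᗮ) :
    IsMinimalExtensionIn T hT A TA (frictionFunction TB hTB G) (orbit T hT A) := by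
  have hmin := h.isMinimalExtensionIn_sup (hT := hT) (hTB := hTB) hAB
  rwa [← hmin.eq_orbit hTA]

theorem HasBlockForm.isMinimalExtensionIn_top_iff (h : HasBlockForm T ⊤ A B TA TB G)
    (hTA : IsSelfAdjoint TA) (hAB : B ≤ Aᗮ) :
    IsMinimalExtensionIn T hT A TA (frictionFunction TB hTB G) ⊤ ↔ orbit T hT A = ⊤ :=
  ⟨fun hmin => (hmin.eq_orbit hTA).symm, fun htop => htop ▸ h.isMinimalExtensionIn_orbit hTA hAB⟩

end Existence

end BlockForm

section Coupling

variable {H : Type*} [NormedAddCommGroup H] [InnerProductSpace ℂ H] [CompleteSpace H]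
  {A : Submodule ℂ H} [CompleteSpace A]
  {T : H →ₗ.[ℂ] H} {TA : A →ₗ.[ℂ] A} {TB : Aᗮ →ₗ.[ℂ] Aᗮ} {G : Aᗮ →L[ℂ] A}

theorem couplingOperator_add (a : A) (b : Aᗮ) :
    couplingOperator A G ((a : H) + b) = (G b : H) + (adjoint G a : H) := by
  have ha : A.orthogonalProjectionOnto ((a : H) + b) = a := by
    rw [map_add, Submodule.orthogonalProjectionOnto_mem_subspace_eq_self,
      Submodule.orthogonalProjectionOnto_apply_of_mem_orthogonal b.2, add_zero]
  have hb : Aᗮ.orthogonalProjectionOnto ((a : H) + b) = b := by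
    rw [map_add, Submodule.orthogonalProjectionOnto_mem_subspace_eq_self,
      Submodule.orthogonalProjectionOnto_apply_of_mem_orthogonal (A.le_orthogonal_orthogonal a.2),
      zero_add]
  change (G (Aᗮ.orthogonalProjectionOnto _) : H) +
    (adjoint G (A.orthogonalProjectionOnto _) : H) = _
  rw [ha, hb]

theorem couplingOperator_coe_left (a : A) : couplingOperator A G a = (adjoint G a : H) := by
  simpa using couplingOperator_add (G := G) a 0

theorem couplingOperator_coe_right (b : Aᗮ) : couplingOperator A G b = (G b : H) := by
  simpa using couplingOperator_add (G := G) 0 b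

theorem couplingOperator_add_eq_zero_iff (a : A) (b : Aᗮ) :
    couplingOperator A G ((a : H) + b) = 0 ↔ G b = 0 ∧ adjoint G a = 0 := by
  rw [couplingOperator_add, ← add_eq_add_iff_of_isOrtho (le_refl Aᗮ)]
  simp

theorem isSelfAdjoint_couplingOperator (G : Aᗮ →L[ℂ] A) :
    IsSelfAdjoint (couplingOperator A G) := by
  have hadj : couplingOperator A G = A.subtypeL ∘L G ∘L Aᗮ.orthogonalProjectionOnto +
      star (A.subtypeL ∘L G ∘L Aᗮ.orthogonalProjectionOnto) := by
    rw [ContinuousLinearMap.star_eq_adjoint, ContinuousLinearMap.adjoint_comp,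
      ContinuousLinearMap.adjoint_comp, Submodule.adjoint_subtypeL,
      Submodule.adjoint_orthogonalProjectionOnto]
    rfl
  rw [hadj]
  exact IsSelfAdjoint.add_star_self _

theorem mem_orthogonal_range_couplingOperator {φ : H} :
    φ ∈ (couplingOperator A G).rangeᗮ ↔ couplingOperator A G φ = 0 := by
  rw [ContinuousLinearMap.orthogonal_range, ← ContinuousLinearMap.star_eq_adjoint,
    (isSelfAdjoint_couplingOperator G).star_eq]
  rfl

theorem HasBlockForm.starProjection_mem_graph (h : HasBlockForm T ⊤ A Aᗮ TA TB G) {x y : H}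
    (hxy : (x, y) ∈ T.graph) (hx : couplingOperator A G x = 0) :
    (A.starProjection x, A.starProjection y) ∈ T.graph := by
  obtain ⟨a, a', b, b', ha, -, rfl, rfl⟩ := h.exists_of_mem_graph Submodule.mem_top hxy
  obtain ⟨hb0, ha0⟩ := (couplingOperator_add_eq_zero_iff a b).mp hx
  have hproj (a : A) (b : Aᗮ) : A.starProjection ((a : H) + b) = a := by
    rw [map_add, A.starProjection_eq_self_iff.mpr a.2,
      A.starProjection_apply_eq_zero_iff.mpr b.2, add_zero]
  rw [hproj, hproj, hb0, add_zero]
  simpa [ha0] using h.mem_graph_left ha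

section Orbit

variable {hT : IsSelfAdjoint T} {M : Submodule ℂ H}

theorem HasBlockForm.cayley_starProjection_apply (h : HasBlockForm T ⊤ A Aᗮ TA TB G)
    (hM : Reduces (cayley T hT : H →L[ℂ] H) M) (hMG : ∀ x ∈ M, couplingOperator A G x = 0)
    {m : H} (hm : m ∈ M) : (cayley T hT : H →L[ℂ] H) (A.starProjection m) =
      A.starProjection ((cayley T hT : H →L[ℂ] H) m) := by
  have : CompleteSpace M := hM.isClosed.completeSpace_coe
  obtain ⟨x, y, hxy, rfl⟩ := surjective_add_smul hT Complex.I (Or.inl rfl) m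
  have hMxy := hM.starProjection_mem_graph hxy
  have hAxy := h.starProjection_mem_graph hMxy (hMG _ (M.starProjection_apply_mem x))
  have hself : M.starProjection y + Complex.I • M.starProjection x = y + Complex.I • x := by
    rw [← map_smul, ← map_add, M.starProjection_eq_self_iff.mpr hm]
  rw [← hself, cayley_spec T hT hMxy, map_add, map_sub, map_smul, cayley_spec T hT hAxy]

theorem HasBlockForm.reduces_closure_map_starProjection (h : HasBlockForm T ⊤ A Aᗮ TA TB G)
    (hM : Reduces (cayley T hT : H →L[ℂ] H) M) (hMG : ∀ x ∈ M, couplingOperator A G x = 0) :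
    Reduces (cayley T hT : H →L[ℂ] H) (M.map A.starProjection.toLinearMap).topologicalClosure := by
  refine reduces_topologicalClosure ?_ ?_
  · rintro _ ⟨m, hm, rfl⟩
    exact ⟨_, hM.mem_invtSubmodule hm, (h.cayley_starProjection_apply hM hMG hm).symm⟩
  · rintro _ ⟨m, hm, rfl⟩
    have hm' : adjoint (cayley T hT : H →L[ℂ] H) m ∈ M := hM.mem_invtSubmodule_adjoint hm
    refine ⟨_, hm', ?_⟩
    set U := (cayley T hT : H →L[ℂ] H) with hUdef
    calc A.starProjection (adjoint U m)
        = adjoint U (U (A.starProjection (adjoint U m))) :=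
          (unitary_adjoint_apply_apply (cayley T hT) _).symm
      _ = adjoint U (A.starProjection (U (adjoint U m))) := by
          rw [h.cayley_starProjection_apply hM hMG hm']
      _ = adjoint U (A.starProjection m) := by
          rw [hUdef, unitary_apply_adjoint_apply]

theorem HasBlockForm.orbit_range_couplingOperator_le (h : HasBlockForm T ⊤ A Aᗮ TA TB G)
    (hTA : IsSelfAdjoint TA) : orbit T hT (couplingOperator A G).range ≤ orbit T hT A := by
  refine (reduces_orbit _).orbit_le ?_
  rintro _ ⟨x, rfl⟩
  change couplingOperator A G x ∈ orbit T hT A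
  obtain ⟨a, ha, b, hb, rfl⟩ := A.exists_add_mem_mem_orthogonal x
  lift a to A using ha
  lift b to Aᗮ using hb
  rw [couplingOperator_add]
  exact add_mem (subset_orbit _ (G b).2)
    (h.adjoint_apply_mem hTA (reduces_orbit _) (subset_orbit _) a)

theorem HasBlockForm.orbit_le_orbit_range_couplingOperator (h : HasBlockForm T ⊤ A Aᗮ TA TB G)
    (hA : HasNoInvariantSubspace T hT A) :
    orbit T hT A ≤ orbit T hT (couplingOperator A G).range := by
  set N := orbit T hT (couplingOperator A G).range
  have hN : Reduces (cayley T hT : H →L[ℂ] H) N := reduces_orbit _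
  have hcoupling : ∀ x ∈ Nᗮ, couplingOperator A G x = 0 := fun x hx =>
    mem_orthogonal_range_couplingOperator.mp (Submodule.orthogonal_le (subset_orbit _) hx)
  have hreduces := h.reduces_closure_map_starProjection hN.orthogonal hcoupling
  have hle : (Nᗮ.map A.starProjection.toLinearMap).topologicalClosure ≤ A := by
    refine Submodule.topologicalClosure_minimal _ ?_
      (completeSpace_coe_iff_isComplete.mp ‹CompleteSpace A›).isClosed
    rintro _ ⟨x, -, rfl⟩
    exact A.starProjection_apply_mem x
  have hbot := hA _ hle (isInvariant_iff_reduces.mpr hreduces)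
  have hNA : Nᗮ ≤ Aᗮ := fun x hx => by
    rw [← A.starProjection_apply_eq_zero_iff, ← Submodule.mem_bot ℂ, ← hbot]
    exact Submodule.le_topologicalClosure _ ⟨x, hx, rfl⟩
  refine hN.orbit_le ?_
  rw [← N.orthogonal_orthogonal]
  exact Submodule.IsOrtho.symm hNA

theorem HasBlockForm.orbit_eq_orbit_range_couplingOperator (h : HasBlockForm T ⊤ A Aᗮ TA TB G)
    (hTA : IsSelfAdjoint TA) (hA : HasNoInvariantSubspace T hT A) :
    orbit T hT A = orbit T hT (couplingOperator A G).range :=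
  le_antisymm (h.orbit_le_orbit_range_couplingOperator hA) (h.orbit_range_couplingOperator_le hTA)

end Orbit

section Eigenmode

theorem HasBlockForm.couplingOperator_eq_zero_of_mem (h : HasBlockForm T ⊤ A Aᗮ TA TB G)
    {z : ℂ} {φ : H} (hφ : φ ∈ eigenspace T z) (hA : φ ∈ A) : couplingOperator A G φ = 0 := by
  lift φ to A using hA
  have hG := h.adjoint_apply_eq_zero_of_mem_graph le_rfl (a' := z • φ) hφ
  rw [couplingOperator_coe_left, hG, Submodule.coe_zero]

theorem HasBlockForm.couplingOperator_eq_zero_of_mem_orthogonal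
    (h : HasBlockForm T ⊤ A Aᗮ TA TB G) {z : ℂ} {φ : H} (hφ : φ ∈ eigenspace T z)
    (hA : φ ∈ Aᗮ) : couplingOperator A G φ = 0 := by
  lift φ to Aᗮ using hA
  have hG := h.swap.adjoint_apply_eq_zero_of_mem_graph A.le_orthogonal_orthogonal (a' := z • φ) hφ
  rw [ContinuousLinearMap.adjoint_adjoint] at hG
  rw [couplingOperator_coe_right, hG, Submodule.coe_zero]

theorem HasBlockForm.starProjection_mem_eigenspace (h : HasBlockForm T ⊤ A Aᗮ TA TB G) {z : ℂ}
    {φ : H} (hφ : φ ∈ eigenspace T z) (hC : couplingOperator A G φ = 0) :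
    A.starProjection φ ∈ eigenspace T z := by
  have hgraph := h.starProjection_mem_graph hφ hC
  rwa [LinearMap.smul_apply, map_smul] at hgraph

theorem HasBlockForm.forall_eigenmode_couplingOperator_ne_zero_iff
    (h : HasBlockForm T ⊤ A Aᗮ TA TB G) :
    (∀ φ, IsEigenmode T φ → couplingOperator A G φ ≠ 0) ↔
      (∀ φ, IsEigenmode T φ → φ ∉ Aᗮ) ∧ ∀ φ, IsEigenmode T φ → φ ∉ Aᗮᗮ := by
  rw [A.orthogonal_orthogonal]
  refine ⟨fun hC => ⟨?_, ?_⟩, ?_⟩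
  · exact fun φ hφ hA => hC φ hφ <|
      hφ.2.elim fun z hz => h.couplingOperator_eq_zero_of_mem_orthogonal hz hA
  · exact fun φ hφ hA => hC φ hφ <|
      hφ.2.elim fun z hz => h.couplingOperator_eq_zero_of_mem hz hA
  · rintro ⟨hAperp, hA⟩ φ ⟨h0, z, hz⟩ hC
    by_cases hP : A.starProjection φ = 0
    · exact hAperp φ ⟨h0, z, hz⟩ (A.starProjection_apply_eq_zero_iff.mp hP)
    · exact hA _ ⟨hP, z, h.starProjection_mem_eigenspace hz hC⟩ (A.starProjection_apply_mem φ)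

end Eigenmode

end Coupling

end OpenSystems

theorem mainTheorem5 {H : Type*} [NormedAddCommGroup H] [InnerProductSpace ℂ H] [CompleteSpace H]
    [TopologicalSpace.SeparableSpace H]
    (Ω : H →ₗ.[ℂ] H) (hΩ : IsSelfAdjoint Ω)
    (H₁ : Submodule ℂ H) [CompleteSpace H₁]
    (Ω₁ : H₁ →ₗ.[ℂ] H₁) (hΩ₁ : IsSelfAdjoint Ω₁)
    (Ω₂ : H₁ᗮ →ₗ.[ℂ] H₁ᗮ) (hΩ₂ : IsSelfAdjoint Ω₂)
    (Γ : H₁ᗮ →L[ℂ] H₁)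
    (hblock : HasBlockForm Ω ⊤ H₁ H₁ᗮ Ω₁ Ω₂ Γ) :
    (∃! K, IsMinimalExtensionIn Ω hΩ H₁ Ω₁ (frictionFunction Ω₂ hΩ₂ Γ) K) ∧
    ∀ Hmin, IsMinimalExtensionIn Ω hΩ H₁ Ω₁ (frictionFunction Ω₂ hΩ₂ Γ) Hmin →
      Hmin = orbit Ω hΩ H₁ ∧
      (HasNoInvariantSubspace Ω hΩ H₁ → Hmin = orbit Ω hΩ (couplingOperator H₁ Γ).range) ∧
      -- pure point spectrum: sums over eigenspaces
      (HasPurePointSpectrum Ω →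
        (eigenvalues Ω).Countable ∧
        IsClosedOrthogonalSum Hmin
          (fun z : eigenvalues Ω => projectedEigenspace Ω hΩ H₁ z) ∧
        (HasNoInvariantSubspace Ω hΩ H₁ →
          IsClosedOrthogonalSum Hmin
            (fun z : eigenvalues Ω =>
              projectedEigenspace Ω hΩ (couplingOperator H₁ Γ).range z))) ∧
      -- general spectrum: spans of spectral projections over intervals
      (Hmin = spectralSpan Ω hΩ intervals H₁ ∧
        ∀ ε : ℝ, 0 < ε → Hmin = spectralSpan Ω hΩ (intervalsOfLength ε) H₁) ∧
      (HasNoInvariantSubspace Ω hΩ H₁ →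
        Hmin = spectralSpan Ω hΩ intervals (couplingOperator H₁ Γ).range ∧
        ∀ ε : ℝ, 0 < ε →
          Hmin = spectralSpan Ω hΩ (intervalsOfLength ε) (couplingOperator H₁ Γ).range) ∧
      -- pure point spectrum: criteria in terms of eigenmodes
      (HasPurePointSpectrum Ω →
        (Hmin = ⊤ ↔ ∀ φ, IsEigenmode Ω φ → H₁.starProjection φ ≠ 0) ∧
        (HasNoInvariantSubspace Ω hΩ H₁ →
          (Hmin = ⊤ ↔ ∀ φ, IsEigenmode Ω φ → couplingOperator H₁ Γ φ ≠ 0)) ∧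
        (IsReconstructible Ω hΩ H₁ Ω₁ hΩ₁ Ω₂ hΩ₂ Γ ↔
          ∀ φ, IsEigenmode Ω φ → couplingOperator H₁ Γ φ ≠ 0)) := by
  have hmin := hblock.isMinimalExtensionIn_orbit (hT := hΩ) (hTB := hΩ₂) hΩ₁ le_rfl
  have hrange := hblock.orbit_eq_orbit_range_couplingOperator (hT := hΩ) hΩ₁
  have hspan (S : Set H) : orbit Ω hΩ S = spectralSpan Ω hΩ intervals S ∧
      ∀ ε : ℝ, 0 < ε → orbit Ω hΩ S = spectralSpan Ω hΩ (intervalsOfLength ε) S :=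
    ⟨orbit_eq_spectralSpan_intervals S, fun ε hε => orbit_eq_spectralSpan_intervalsOfLength hε S⟩
  refine ⟨⟨_, hmin, fun K hK => hK.eq_orbit hΩ₁⟩, fun Hmin hHmin => ?_⟩
  obtain rfl := hHmin.eq_orbit hΩ₁
  refine ⟨rfl, hrange, fun hpp => ⟨countable_eigenvalues hΩ, isClosedOrthogonalSum_orbit hpp H₁,
    fun hni => ?_⟩, hspan H₁, fun hni => ?_, fun hpp => ⟨?_, fun hni => ?_, ?_⟩⟩
  · rw [hrange hni]
    exact isClosedOrthogonalSum_orbit hpp _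
  · rw [hrange hni]
    exact hspan _
  · simp only [orbit_eq_top_iff hpp, ne_eq, H₁.starProjection_apply_eq_zero_iff]
  · rw [hrange hni]
    simp only [orbit_eq_top_iff hpp, mem_orthogonal_range_couplingOperator, ne_eq]
  · rw [IsReconstructible, hblock.isMinimalExtensionIn_top_iff hΩ₁ le_rfl,
      hblock.swap.isMinimalExtensionIn_top_iff hΩ₂ H₁.le_orthogonal_orthogonal,
      orbit_eq_top_iff hpp, orbit_eq_top_iff hpp,
      hblock.forall_eigenmode_couplingOperator_ne_zero_iff]
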